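/- Let $n\ge 1$. Let $\mathrm{Conv}_c(\mathbb{R}^n)$ be the set of convex functions $\psi:\mathbb{R}^n\to(-\infty,\infty]$ that are coercive ($\psi(x)\to\infty$ as $|x|\to\infty$), proper ($\psi\not\equiv\infty$) and lower semicontinuous. Write $(\psi_1\square\psi_2)(x)=\inf_{y}(\psi_1(x-y)+\psi_2(y))$ for infimal convolution, $(\lambda\cdot\psi)(x)=\lambda\psi(x/\lambda)$ for epi-multiplication with $\lambda>0$, and $\mathcal{L}\psi(x)=\sup_{y}(\langle x,y\rangle-\psi(y))$ for the convex conjugate, with $\mathrm{dom}(\mathcal{L}\psi)=\{\mathcal{L}\psi<\infty\}$. A sequence $\psi_j$ epi-converges to $\psi$ if for every $x$ one has $\psi(x)\le\liminf_j\psi_j(x_j)$ whenever $x_j\to x$, and $\psi_j(x_j)\to\psi(x)$ for some sequence $x_j\to x$. For $\psi\in\mathrm{Conv}_c(\mathbb{R}^n)$ and $y\in\mathbb{R}^n$ let $\ell_{\psi,y}(x)=\langle x,y\rangle+c$, where $c\in[-\infty,\infty)$ is the largest number with $\ell_{\psi,y}\le\psi$ ($c=-\infty$ if no real number has this property), and for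 $Y\subseteq\mathbb{R}^n$ let $q_{\psi,Y}=\sup_{y\in Y}\ell_{\psi,y}$. Let $B_n$ be the closed Euclidean unit ball, $r(\psi)=\sup\{r\ge 0: rB_n\subseteq\mathrm{dom}(\mathcal{L}\psi)\}\in(0,\infty]$, with $r(\psi)B_n=\mathbb{R}^n$ if $r(\psi)=\infty$, and let $$\mathscr{Y}_\psi=\{Y\subseteq\mathbb{R}^n:\ \exists\, Y_0\subseteq Y \text{ with } \mathrm{pos}(Y_0)=\mathbb{R}^n,\ Y_0\subseteq\mathrm{int}(r(\psi)B_n)\},$$ where $\mathrm{pos}$ is the positive hull, i.e. the set of all finite linear combinations with nonnegative coefficients. Let $G_n=\mathrm{SO}(n)$ if $n\ge 2$ and $G_1=\mathrm{O}(1)=\{\pm1\}$. For $\Phi:\mathrm{Conv}_c(\mathbb{R}^n)\to[-\infty,\infty]$ and a collection $\mathcal{Y}$ of subsets of $\mathbb{R}^n$ such that every $q_{\psi\circ\vartheta^{-1},Y}$ below is in $\mathrm{Conv}_c(\mathbb{R}^n)$, put $$\Phi^*(\psi,\mathcal{Y})=\inf\{\Phi(q_{\psi\circ\vartheta^{-1},Y}):\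 \vartheta\in G_n,\ Y\in\mathcal{Y}\},\qquad \inf\emptyset=\infty.$$ For every $\psi\in\mathrm{Conv}_c(\mathbb{R}^n)$ there is a unique $\psi_{\mathrm{rot}}\in\mathrm{Conv}_c(\mathbb{R}^n)$, the rotational epi-symmetrization of $\psi$, such that, if $n\ge 2$, $\mathcal{L}\psi_{\mathrm{rot}}(x)=\int_{\mathrm{SO}(n)}\mathcal{L}\psi(\vartheta^{-1}x)\,d\vartheta$ for all $x\in\mathbb{R}^n$, where $d\vartheta$ is the Haar probability measure, and, if $n=1$, $\psi_{\mathrm{rot}}=\tfrac12\cdot(\psi\,\square\,\psi^-)$, where $\psi^-(x)=\psi(-x)$. **Theorem.** Let $\Phi:\mathrm{Conv}_c(\mathbb{R}^n)\to[-\infty,\infty]$ be a functional that does not attain both values $-\infty$ and $\infty$ and that is - upper semicontinuous: $\limsup_j\Phi(\psi_j)\le\Phi(\psi)$ whenever $\psi_j,\psi\in\mathrm{Conv}_c(\mathbb{R}^n)$ and $\psi_j$ epi-converges to $\psi$; - concave: $\Phi(\lambda\cdot\psi_1\,\square\,(1-\lambda)\cdot\psi_2)\ge\lambda\Phi(\psi_1)+(1-\lambda)\Phi(\psi_2)$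 for all $\psi_1,\psi_2\in\mathrm{Conv}_c(\mathbb{R}^n)$ and $\lambda\in(0,1)$; - monotone decreasing: $\Phi(\psi_1)\le\Phi(\psi_2)$ whenever $\psi_1\ge\psi_2$ pointwise. Then for every $\psi\in\mathrm{Conv}_c(\mathbb{R}^n)$ and every $\mathcal{Y}\subseteq\mathscr{Y}_\psi$, the functions $q_{\psi\circ\vartheta^{-1},Y}$ and $q_{\psi_{\mathrm{rot}}\circ\vartheta^{-1},Y}$ belong to $\mathrm{Conv}_c(\mathbb{R}^n)$ for every $Y\in\mathcal{Y}$ and $\vartheta\in\mathrm{O}(n)$, and $$\Phi^*(\psi,\mathcal{Y})\le\Phi^*(\psi_{\mathrm{rot}},\mathcal{Y}).$$ -/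

import Mathlib

open Filter Topology MeasureTheory
open scoped ENNReal NNReal

noncomputable section

/-- `ℝⁿ` with its Euclidean norm and inner product. -/
abbrev Euc (n : ℕ) : Type := EuclideanSpace ℝ (Fin n)

/-! ### Coercive convex functions -/

/-- Membership in `Conv_c(ℝⁿ)`: convex functions `ψ : ℝⁿ → (-∞, ∞]` that are coercive, proper and
lower semicontinuous. -/
structure IsConvC {n : ℕ} (ψ : Euc n → EReal) : Prop where
  ne_bot : ∀ x, ψ x ≠ ⊥
  convex : ∀ x y : Euc n, ∀ a b : ℝ, 0 < a → 0 < b → a + b = 1 →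
    ψ (a • x + b • y) ≤ (a : EReal) * ψ x + (b : EReal) * ψ y
  coercive : Tendsto ψ (comap (fun x : Euc n => ‖x‖) atTop) (𝓝 ⊤)
  proper : ∃ x, ψ x < ⊤
  lsc : LowerSemicontinuous ψ

/-- The set `Conv_c(ℝⁿ)` as a type. -/
abbrev ConvC (n : ℕ) : Type := {ψ : Euc n → EReal // IsConvC ψ}

/-- Infimal convolution (epi-sum). -/
def infConv {n : ℕ} (f g : Euc n → EReal) (x : Euc n) : EReal :=
  ⨅ y : Euc n, f (x - y) + g y

/-- Epi-multiplication of `f` with `l > 0`. -/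
def epiMul {n : ℕ} (l : ℝ) (f : Euc n → EReal) (x : Euc n) : EReal :=
  (l : EReal) * f (l⁻¹ • x)

/-- Convex conjugate (Legendre-Fenchel transform). -/
def legendre {n : ℕ} (f : Euc n → EReal) (x : Euc n) : EReal :=
  ⨆ y : Euc n, ((inner ℝ x y : ℝ) : EReal) - f y

/-- The domain of an extended-real-valued function. -/
def effDom {n : ℕ} (f : Euc n → EReal) : Set (Euc n) := {x | f x < ⊤}

/-- Epi-convergence of a sequence of functions. -/
def EpiConverges {n : ℕ} (f : ℕ → Euc n → EReal) (g : Euc n → EReal) : Prop :=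
  ∀ x : Euc n,
    (∀ u : ℕ → Euc n, Tendsto u atTop (𝓝 x) → g x ≤ liminf (fun j => f j (u j)) atTop) ∧
    ∃ u : ℕ → Euc n, Tendsto u atTop (𝓝 x) ∧ Tendsto (fun j => f j (u j)) atTop (𝓝 (g x))

/-! ### Functionals on coercive convex functions -/

/-- The functional does not attain both values `-∞` and `∞`. -/
def OneSided {n : ℕ} (Φ : ConvC n → EReal) : Prop :=
  (∀ ψ, Φ ψ ≠ ⊥) ∨ (∀ ψ, Φ ψ ≠ ⊤)

/-- Upper semicontinuity with respect to epi-convergence. -/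
def EpiUSC {n : ℕ} (Φ : ConvC n → EReal) : Prop :=
  ∀ (f : ℕ → ConvC n) (g : ConvC n), EpiConverges (fun j => (f j).1) g.1 →
    limsup (fun j => Φ (f j)) atTop ≤ Φ g

/-- Concavity with respect to infimal convolution and epi-multiplication; here `φ` is the element
`l · ψ₁ □ (1 - l) · ψ₂` of `Conv_c(ℝⁿ)`. -/
def EpiConcave {n : ℕ} (Φ : ConvC n → EReal) : Prop :=
  ∀ (ψ₁ ψ₂ φ : ConvC n) (l : ℝ), 0 < l → l < 1 →
    φ.1 = infConv (epiMul l ψ₁.1) (epiMul (1 - l) ψ₂.1) →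
    (l : EReal) * Φ ψ₁ + ((1 - l : ℝ) : EReal) * Φ ψ₂ ≤ Φ φ

/-- Monotone decreasing functionals. -/
def EpiDecreasing {n : ℕ} (Φ : ConvC n → EReal) : Prop :=
  ∀ ψ₁ ψ₂ : ConvC n, (∀ x, ψ₂.1 x ≤ ψ₁.1 x) → Φ ψ₁ ≤ Φ ψ₂

/-! ### Rotations -/

/-- The orthogonal group `O(n)`. -/
abbrev On (n : ℕ) : Type := Matrix.orthogonalGroup (Fin n) ℝ

/-- The rotation group `SO(n)`, as a subgroup of `O(n)`. -/
def SOn (n : ℕ) : Subgroup (On n) where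
  carrier := {ϑ | Matrix.det (ϑ : Matrix (Fin n) (Fin n) ℝ) = 1}
  mul_mem' := by
    intro a b ha hb
    simp only [Set.mem_ofPred_eq] at ha hb ⊢
    simp [ha, hb]
  one_mem' := by simp
  inv_mem' := by
    intro a ha
    simp only [Set.mem_ofPred_eq] at ha ⊢
    have h : ((a⁻¹ : On n) : Matrix (Fin n) (Fin n) ℝ) * (a : Matrix (Fin n) (Fin n) ℝ) = 1 := by
      rw [← Submonoid.coe_mul, inv_mul_cancel]; rfl
    have h2 := congrArg Matrix.det h
    rw [Matrix.det_mul, ha, mul_one, Matrix.det_one] at h2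
    exact h2

/-- The function `ψ ∘ ϑ⁻¹`. -/
def rotated {n : ℕ} (ψ : Euc n → EReal) (ϑ : On n) (x : Euc n) : EReal :=
  ψ (Matrix.toEuclideanLin ((ϑ⁻¹ : On n) : Matrix (Fin n) (Fin n) ℝ) x)

theorem isCompact_orthogonal (n : ℕ) :
    IsCompact {A : Matrix (Fin n) (Fin n) ℝ | A ∈ Matrix.orthogonalGroup (Fin n) ℝ} := by
  have hb : IsCompact (Set.pi Set.univ fun _ : Fin n => Set.pi Set.univ fun _ : Fin n =>
      Set.Icc (-1 : ℝ) 1) :=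
    isCompact_univ_pi fun _ => isCompact_univ_pi fun _ => isCompact_Icc
  refine IsCompact.of_isClosed_subset (X := Matrix (Fin n) (Fin n) ℝ) hb ?_ ?_
  · simp only [Matrix.mem_orthogonalGroup_iff]
    exact isClosed_eq (continuous_id.matrix_mul continuous_id.matrix_transpose) continuous_const
  · intro A hA i _ j _
    have h := congrFun (congrFun ((Matrix.mem_orthogonalGroup_iff (Fin n) ℝ).1 hA) i) i
    simp only [Matrix.mul_apply, Matrix.transpose_apply, Matrix.one_apply_eq] at h
    have h2 : A i j * A i j ≤ 1 := by
      rw [← h]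
      exact Finset.single_le_sum (f := fun k => A i k * A i k)
        (fun k _ => mul_self_nonneg (A i k)) (Finset.mem_univ j)
    constructor <;> nlinarith

instance compactSpace_On (n : ℕ) : CompactSpace (On n) :=
  isCompact_iff_compactSpace.1 (isCompact_orthogonal n)

instance compactSpace_SOn (n : ℕ) : CompactSpace (SOn n) := by
  have h : IsClosed ((SOn n : Set (On n))) :=
    isClosed_eq (continuous_subtype_val.matrix_det) continuous_const
  exact isCompact_iff_compactSpace.1 h.isCompact

instance measurableSpace_SOn (n : ℕ) : MeasurableSpace (SOn n) := borel _

instance borelSpace_SOn (n : ℕ) : BorelSpace (SOn n) := ⟨rfl⟩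

/-- The Haar probability measure on `SO(n)`. -/
def haarSOn (n : ℕ) : Measure (SOn n) := Measure.haarMeasure ⊤

/-- The integral of an extended-real-valued function, as the integral of its positive part minus
that of its negative part. -/
def eintegral {α : Type*} [MeasurableSpace α] (μ : Measure α) (f : α → EReal) : EReal :=
  ((∫⁻ a, (f a).toENNReal ∂μ : ℝ≥0∞) : EReal) - ((∫⁻ a, (-f a).toENNReal ∂μ : ℝ≥0∞) : EReal)

/-- The average `x ↦ ∫_{SO(n)} g(ϑ⁻¹ x) dϑ` with respect to the Haar probability measure. -/
def rotAverage {n : ℕ} (g : Euc n → EReal) (x : Euc n) : EReal :=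
  eintegral (haarSOn n) fun ϑ : SOn n => rotated g (ϑ : On n) x

/-- `φ` is the rotational epi-symmetrization of `ψ`: for `n ≠ 1`, the convex conjugate of `φ` is the
Haar average over `SO(n)` of the rotated convex conjugates of `ψ`; for `n = 1`,
`φ = (1/2) · (ψ □ ψ⁻)` with `ψ⁻(x) = ψ(-x)`. -/
def IsRotSymm {n : ℕ} (ψ φ : ConvC n) : Prop :=
  if n = 1 then φ.1 = epiMul (1 / 2) (infConv ψ.1 fun x => ψ.1 (-x))
  else legendre φ.1 = rotAverage (legendre ψ.1)

/-! ### Generalized outer linearizations -/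

/-- The largest `c ∈ [-∞, ∞)` such that `x ↦ ⟨x, y⟩ + c` is bounded from above by `ψ`
(`-∞` if no real number has this property). -/
def slopeConst {n : ℕ} (ψ : Euc n → EReal) (y : Euc n) : EReal :=
  ⨆ (c : ℝ) (_ : ∀ x : Euc n, ((inner ℝ x y + c : ℝ) : EReal) ≤ ψ x), (c : EReal)

/-- The largest affine function `ℓ_{ψ,y}` with gradient `y` that is bounded from above by `ψ`. -/
def maxAffine {n : ℕ} (ψ : Euc n → EReal) (y x : Euc n) : EReal :=
  ((inner ℝ x y : ℝ) : EReal) + slopeConst ψ y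

/-- The generalized outer linearization `q_{ψ,Y}`. -/
def outerLin {n : ℕ} (ψ : Euc n → EReal) (Y : Set (Euc n)) (x : Euc n) : EReal :=
  ⨆ y ∈ Y, maxAffine ψ y x

/-- The number `r(ψ) = sup {r ≥ 0 : r Bₙ ⊆ dom (𝓛 ψ)} ∈ [0, ∞]`. -/
def conjRadius {n : ℕ} (ψ : Euc n → EReal) : ℝ≥0∞ :=
  ⨆ (ρ : ℝ≥0) (_ : Metric.closedBall (0 : Euc n) ρ ⊆ effDom (legendre ψ)), (ρ : ℝ≥0∞)

/-- The collection `𝒴_ψ` of all sets `Y` of slopes that contain a subset `Y₀` of the interior of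
`r(ψ) Bₙ` with positive hull `ℝⁿ`. This interior is the open ball of radius `r(ψ)`, which is
all of `ℝⁿ` for `r(ψ) = ∞`. -/
def admissibleSlopes {n : ℕ} (ψ : Euc n → EReal) : Set (Set (Euc n)) :=
  {Y | ∃ Y₀ ⊆ Y, PointedCone.hull ℝ Y₀ = ⊤ ∧ Y₀ ⊆ Metric.eball (0 : Euc n) (conjRadius ψ)}

/-- The group over which the infimum in `Φ*` is taken: `SO(n)`, but `O(1)` for `n = 1`. -/
def motionGroup (n : ℕ) : Subgroup (On n) := if n = 1 then ⊤ else SOn n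

/-- The value `Φ*(ψ, 𝒴)`: the infimum of `Φ(q_{ψ ∘ ϑ⁻¹, Y})` over rotations `ϑ` and `Y ∈ 𝒴`.
Pairs `(ϑ, Y)` for which `q_{ψ ∘ ϑ⁻¹, Y}` is not in the domain `Conv_c(ℝⁿ)` of `Φ` would not
contribute; there are none if `𝒴` is admissible. -/
def bestValue {n : ℕ} (Φ : ConvC n → EReal) (ψ : ConvC n) (𝒴 : Set (Set (Euc n))) : EReal :=
  ⨅ (ϑ : On n) (_ : ϑ ∈ motionGroup n) (Y : Set (Euc n)) (_ : Y ∈ 𝒴)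
    (h : IsConvC (outerLin (rotated ψ.1 ϑ) Y)), Φ ⟨outerLin (rotated ψ.1 ϑ) Y, h⟩

end

/-! Fix finitely many slopes `v i` that positively span `ℝⁿ` and let only the intercepts vary: `a ↦
affSup v a` maps `ι → ℝ` into `Conv_c`. For any level `c` the intercept vectors with `c ≤ Φ (affSup
v a)` form a convex set, by concavity and monotonicity of `Φ` (`convex_superlevel`), and a closed
one, by upper semicontinuity (`isClosed_superlevel`).

The best intercept for slope `y` under `ψ` is `-𝓛ψ(y)` (`slopeConst_eq`), so an outer linearization
is a supremum of affine functions whose intercepts are values of the conjugate. Symmetrizing `ψ`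
averages exactly these values over the group. Take `c = Φ*(ψ, 𝒴)` and `Y ∈ 𝒴`. If the `v i` lie in
`Y`, every vector of finite values of `𝓛(ψ ∘ ϑ⁻¹)` at the `v i` lies in the superlevel set, because
the finite supremum is below `q_{ψ ∘ ϑ⁻¹, Y}` and `Φ` is decreasing. The vector belonging to `ψrot ∘
η⁻¹` is a mean of such vectors, and a closed convex set contains the means of its points
(`legendre_mem_of_isRotSymm`, `le_affSup_of_isRotSymm`).

For general `Y`, `q_{ψrot ∘ η⁻¹, Y}` is an epi-limit of suprema over finite subfamilies, and upper
semicontinuity passes the bound `c` to the limit (`le_outerLin_of_isRotSymm`). Existence and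
uniqueness of `ψrot` rest on Fenchel-Moreau; admissibility of the slopes keeps the conjugates finite
on a positively spanning finite set. -/

/-! ### Convexity of extended-real-valued functions -/

/-- Convexity of an extended-real-valued function, expressed through real upper bounds. -/
def EConvex {n : ℕ} (f : Euc n → EReal) : Prop :=
  ∀ x y : Euc n, ∀ a b : ℝ, 0 < a → 0 < b → a + b = 1 → ∀ r s : ℝ, f x ≤ r → f y ≤ s →
    f (a • x + b • y) ≤ ((a * r + b * s : ℝ) : EReal)

theorem IsConvC.econvex {n : ℕ} {f : Euc n → EReal} (hf : IsConvC f) : EConvex f := by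
  intro x y a b ha hb hab r s hr hs
  refine (hf.convex x y a b ha hb hab).trans ?_
  push_cast
  gcongr

theorem EConvex.le {n : ℕ} {f : Euc n → EReal} (hf : EConvex f) (hbot : ∀ x, f x ≠ ⊥)
    (x y : Euc n) (a b : ℝ) (ha : 0 < a) (hb : 0 < b) (hab : a + b = 1) :
    f (a • x + b • y) ≤ (a : EReal) * f x + (b : EReal) * f y := by
  have key := hf x y a b ha hb hab
  have hx := hbot x
  have hy := hbot y
  generalize f x = u at *
  generalize f y = v at *
  induction u with
  | bot => exact absurd rfl hx
  | top =>
    rw [EReal.coe_mul_top_of_pos ha]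
    induction v with
    | bot => exact absurd rfl hy
    | top => rw [EReal.coe_mul_top_of_pos hb]; simp
    | coe s => rw [← EReal.coe_mul, EReal.top_add_coe]; exact le_top
  | coe r =>
    induction v with
    | bot => exact absurd rfl hy
    | top => rw [EReal.coe_mul_top_of_pos hb, ← EReal.coe_mul, EReal.coe_add_top]; exact le_top
    | coe s => exact_mod_cast key r s le_rfl le_rfl

theorem EConvex.convexOn_toReal {n : ℕ} {f : Euc n → EReal} (hf : EConvex f)
    (hbot : ∀ x, f x ≠ ⊥) {s : Set (Euc n)} (hs : Convex ℝ s) (hsf : s ⊆ effDom f) :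
    ConvexOn ℝ s fun x => (f x).toReal := by
  rw [convexOn_iff_forall_pos]
  refine ⟨hs, fun x hx y hy a b ha hb hab => ?_⟩
  have h := hf x y a b ha hb hab (f x).toReal (f y).toReal
    (EReal.le_coe_toReal (hsf hx).ne) (EReal.le_coe_toReal (hsf hy).ne)
  have := EReal.toReal_le_toReal h (hbot _) (EReal.coe_ne_top _)
  rwa [EReal.toReal_coe] at this

/-! ### The convex conjugate -/

/-- Both sides agree also at `u = ⊥` (false) and `u = ⊤` (true), so real upper bounds on a conjugate
turn into affine minorants with no side conditions. -/
theorem EReal.coe_sub_le_coe_iff (p c : ℝ) (u : EReal) :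
    (p : EReal) - u ≤ (c : EReal) ↔ ((p - c : ℝ) : EReal) ≤ u := by
  induction u with
  | bot => simp [-EReal.coe_sub]
  | top => simp [-EReal.coe_sub]
  | coe r =>
    rw [← EReal.coe_sub, EReal.coe_le_coe_iff, EReal.coe_le_coe_iff]
    constructor <;> intro h <;> linarith

theorem legendre_le_coe_iff {n : ℕ} {f : Euc n → EReal} {y : Euc n} {c : ℝ} :
    legendre f y ≤ (c : EReal) ↔ ∀ x, ((inner ℝ y x - c : ℝ) : EReal) ≤ f x := by
  simp only [legendre, iSup_le_iff, EReal.coe_sub_le_coe_iff]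

theorem legendre_ne_bot {n : ℕ} {f : Euc n → EReal} (hf : ∃ x, f x < ⊤) (y : Euc n) :
    legendre f y ≠ ⊥ := by
  obtain ⟨x, hx⟩ := hf
  intro h
  have h1 : ((inner ℝ y x : ℝ) : EReal) - f x ≤ ⊥ := 
    h ▸ le_iSup (fun z => ((inner ℝ y z : ℝ) : EReal) - f z) x
  generalize f x = u at *
  induction u with
  | bot => simp at h1
  | top => simp at hx
  | coe r => rw [← EReal.coe_sub] at h1; exact absurd h1 (by simp [-EReal.coe_sub])

theorem econvex_legendre {n : ℕ} (f : Euc n → EReal) : EConvex (legendre f) := by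
  intro x y a b ha hb hab r s hr hs
  rw [legendre_le_coe_iff] at *
  intro z
  have h1 := hr z
  have h2 := hs z
  generalize f z = u at *
  induction u with
  | bot => exact absurd h1 (by simp [-EReal.coe_sub])
  | top => exact le_top
  | coe t =>
    rw [EReal.coe_le_coe_iff] at *
    rw [inner_add_left, real_inner_smul_left, real_inner_smul_left]
    have : t = a * t + b * t := by rw [← add_mul, hab, one_mul]
    rw [this]
    nlinarith

theorem lowerSemicontinuous_legendre {n : ℕ} (f : Euc n → EReal) :
    LowerSemicontinuous (legendre f) := by
  refine lowerSemicontinuous_iSup fun z => Continuous.lowerSemicontinuous ?_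
  generalize f z = u
  induction u with
  | bot => simpa using continuous_const
  | top => simpa using continuous_const
  | coe t =>
    simp only [← EReal.coe_sub]
    exact continuous_coe_real_ereal.comp (by fun_prop)

/-- Separation of a point below the graph of a convex lower semicontinuous function from its
epigraph. -/
theorem EConvex.exists_separation {n : ℕ} {f : Euc n → EReal} (hf : EConvex f)
    (hlsc : LowerSemicontinuous f) (hp : ∃ x, f x < ⊤) (x : Euc n) (r : ℝ) (hr : (r : EReal) < f x) :
    ∃ (y : Euc n) (s u : ℝ), 0 ≤ s ∧ inner ℝ y x + s * r < u ∧
      ∀ z (t : ℝ), f z ≤ t → u < inner ℝ y z + s * t := by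
  set S : Set (Euc n × ℝ) := {p | f p.1 ≤ (p.2 : EReal)} with hS
  have hcl : IsClosed S := by
    have := (lowerSemicontinuous_iff_isClosed_epigraph.1 hlsc)
    exact this.preimage (f := fun p : Euc n × ℝ => (p.1, (p.2 : EReal)))
      (continuous_fst.prodMk (continuous_coe_real_ereal.comp continuous_snd))
  have hcv : Convex ℝ S := by
    rw [convex_iff_forall_pos]
    intro p hp q hq a b ha hb hab
    simpa [hS] using hf p.1 q.1 a b ha hb hab p.2 q.2 hp hq
  have hxS : (x, r) ∉ S := by simpa [hS] using hr
  obtain ⟨ℓ, u, h1, h2⟩ := geometric_hahn_banach_point_closed hcv hcl hxS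
  set y := (InnerProductSpace.toDual ℝ (Euc n)).symm (ℓ.comp (ContinuousLinearMap.inl ℝ _ _))
  have hℓ : ∀ z t, ℓ (z, t) = inner ℝ y z + ℓ (0, 1) * t := by
    intro z t
    have e : (z, t) = (z, (0 : ℝ)) + t • ((0 : Euc n), (1 : ℝ)) := by simp
    rw [e, map_add, map_smul]
    simp [y, InnerProductSpace.toDual_symm_apply, mul_comm]
  refine ⟨y, ℓ (0, 1), u, ?_, by rw [← hℓ]; exact h1, fun z t hzt => by rw [← hℓ]; exact h2 _ hzt⟩
  by_contra! hneg
  obtain ⟨z, hz⟩ := hp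
  obtain ⟨t, ht, -⟩ := EReal.lt_iff_exists_real_btwn.1 hz
  set s := ℓ (0, 1)
  -- If `s < 0`, moving up inside the epigraph pushes the functional down; at this height above `z`
  -- it has dropped to at most `u`.
  set T := max t ((u - inner ℝ y z) / s) with hT
  have h3 := h2 (z, T) (by
    simp only [hS, Set.mem_ofPred_eq]
    exact ht.le.trans (EReal.coe_le_coe_iff.2 (le_max_left _ _)))
  rw [hℓ] at h3
  have h4 : (u - inner ℝ y z) / s ≤ T := le_max_right _ _
  rw [div_le_iff_of_neg hneg] at h4
  linarith [mul_comm T s]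

/-- A non-vertical separating hyperplane (`s > 0`) is the graph of the minorant sought. A vertical
one (`s = 0`) is used to tilt some fixed affine minorant. -/
theorem EConvex.exists_affine_le {n : ℕ} {f : Euc n → EReal} (hf : EConvex f)
    (hlsc : LowerSemicontinuous f) (hp : ∃ x, f x < ⊤) (hbot : ∀ x, f x ≠ ⊥)
    (x : Euc n) (r : ℝ) (hr : (r : EReal) < f x) :
    ∃ (y : Euc n) (c : ℝ), (∀ z, ((inner ℝ y z - c : ℝ) : EReal) ≤ f z) ∧ r ≤ inner ℝ y x - c := by
  have main : ∀ (x : Euc n) (r : ℝ) (y : Euc n) (s u : ℝ), 0 < s → inner ℝ y x + s * r < u →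
      (∀ z (t : ℝ), f z ≤ t → u < inner ℝ y z + s * t) →
      ∃ (y : Euc n) (c : ℝ), (∀ z, ((inner ℝ y z - c : ℝ) : EReal) ≤ f z) ∧
        r ≤ inner ℝ y x - c := by
    intro x r y s u hs h1 h2
    refine ⟨-(s⁻¹ • y), -(u / s), fun z => ?_, ?_⟩
    · have h3 := h2 z
      have hz := hbot z
      generalize f z = v at *
      induction v with
      | bot => exact absurd rfl hz
      | top => exact le_top
      | coe t =>
        have h4 := h3 t le_rfl
        rw [EReal.coe_le_coe_iff, inner_neg_left, real_inner_smul_left]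
        have : t = (inner ℝ y z + s * t) / s - s⁻¹ * inner ℝ y z := by field_simp; ring
        rw [this]
        have := div_le_div_of_nonneg_right h4.le hs.le
        linarith
    · rw [inner_neg_left, real_inner_smul_left]
      have : r = (inner ℝ y x + s * r) / s - s⁻¹ * inner ℝ y x := by field_simp; ring
      have := div_le_div_of_nonneg_right h1.le hs.le
      linarith
  obtain ⟨y, s, u, hs, h1, h2⟩ := hf.exists_separation hlsc hp x r hr
  rcases hs.lt_or_eq with hs | rfl
  · exact main x r y s u hs h1 h2
  · obtain ⟨x₀, hx₀⟩ := hp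
    lift f x₀ to ℝ using ⟨hx₀.ne, hbot x₀⟩ with m hm
    -- Separating below a point where `f` is finite cannot give a vertical hyperplane, since `(x₀,
    -- m)` and `(x₀, m - 1)` must lie on different sides.
    obtain ⟨y₀, c₀, h0, -⟩ : ∃ (y : Euc n) (c : ℝ),
        (∀ z, ((inner ℝ y z - c : ℝ) : EReal) ≤ f z) ∧ m - 1 ≤ inner ℝ y x₀ - c := by
      obtain ⟨y', s', u', hs', h1', h2'⟩ := hf.exists_separation hlsc ⟨x₀, hm ▸ hx₀⟩ x₀ (m - 1)
        (by rw [← hm, EReal.coe_lt_coe_iff]; linarith)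
      refine main x₀ (m - 1) y' s' u' ?_ h1' h2'
      have := h2' x₀ m hm.symm.le
      nlinarith
    simp only [zero_mul, add_zero] at h1 h2
    -- Adding `k (u - ⟨y, ·⟩)` lowers the minorant wherever `f` is finite and raises it at `x`; `k`
    -- is large enough to reach `r` there.
    obtain ⟨k, hk⟩ := exists_nat_ge ((r - (inner ℝ y₀ x - c₀)) / (u - inner ℝ y x))
    rw [div_le_iff₀ (by linarith)] at hk
    refine ⟨y₀ - (k : ℝ) • y, c₀ - k * u, fun z => ?_, ?_⟩
    · have h3 := h2 z
      have h4 := h0 z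
      have hz := hbot z
      generalize f z = v at *
      induction v with
      | bot => exact absurd rfl hz
      | top => exact le_top
      | coe t =>
        have h5 := h3 t le_rfl
        rw [EReal.coe_le_coe_iff] at *
        rw [inner_sub_left, real_inner_smul_left]
        have : (0 : ℝ) ≤ k := Nat.cast_nonneg k
        nlinarith
    · rw [inner_sub_left, real_inner_smul_left]
      linarith

/-- The Fenchel-Moreau theorem. -/
theorem EConvex.legendre_legendre {n : ℕ} {f : Euc n → EReal} (hf : EConvex f)
    (hlsc : LowerSemicontinuous f) (hp : ∃ x, f x < ⊤) (hbot : ∀ x, f x ≠ ⊥) :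
    legendre (legendre f) = f := by
  funext x
  refine le_antisymm (iSup_le fun y => ?_) ?_
  · have h1 : ∀ c : ℝ, legendre f y ≤ c → ((inner ℝ x y - c : ℝ) : EReal) ≤ f x := by
      intro c hc
      rw [real_inner_comm]
      exact legendre_le_coe_iff.1 hc x
    have h2 := legendre_ne_bot hp y
    generalize legendre f y = v at *
    induction v with
    | bot => exact absurd rfl h2
    | top => simp
    | coe c => exact_mod_cast h1 c le_rfl
  · rw [← EReal.ge_of_forall_gt_iff_ge]
    intro r hr
    obtain ⟨y, c, h1, h2⟩ := hf.exists_affine_le hlsc hp hbot x r hr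
    refine le_trans ?_ (le_iSup (fun y => ((inner ℝ x y : ℝ) : EReal) - legendre f y) y)
    refine le_trans (EReal.coe_le_coe_iff.2 h2) ?_
    rw [EReal.coe_sub, real_inner_comm]
    exact EReal.sub_le_sub le_rfl (legendre_le_coe_iff.2 h1)

/-! ### Linear growth of coercive convex functions -/

theorem tendsto_top_of_linear_growth {n : ℕ} {f : Euc n → EReal} {δ c : ℝ} (hδ : 0 < δ)
    (h : ∀ x, ((δ * ‖x‖ - c : ℝ) : EReal) ≤ f x) :
    Tendsto f (comap (fun x : Euc n => ‖x‖) atTop) (𝓝 ⊤) := by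
  refine tendsto_nhds_top_mono ?_ (Eventually.of_forall h)
  rw [EReal.tendsto_coe_nhds_top_iff]
  exact tendsto_atTop_add_const_right _ (-c) (tendsto_comap.const_mul_atTop hδ)

/-- By convexity, a rise of at least `1` from `x₀` to the sphere of radius `R` persists beyond it
with slope at least `1 / R`. Inside the ball the lower semicontinuous minimum suffices. -/
theorem IsConvC.exists_linear_growth {n : ℕ} {f : Euc n → EReal} (hf : IsConvC f) :
    ∃ δ > 0, ∃ c : ℝ, ∀ x, ((δ * ‖x‖ - c : ℝ) : EReal) ≤ f x := by
  obtain ⟨x₀, hx₀⟩ := hf.proper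
  lift f x₀ to ℝ using ⟨hx₀.ne, hf.ne_bot x₀⟩ with m hm
  have h1 := EReal.tendsto_nhds_top_iff_real.1 hf.coercive (m + 1)
  rw [eventually_comap] at h1
  obtain ⟨R₀, hR₀⟩ := eventually_atTop.1 h1
  set R := max (R₀ + ‖x₀‖) 1 with hR
  have hRpos : 0 < R := lt_of_lt_of_le one_pos (le_max_right _ _)
  have hfar : ∀ z, R ≤ ‖z - x₀‖ → ((m + 1 : ℝ) : EReal) < f z := by
    intro z hz
    refine hR₀ ‖z‖ ?_ z rfl
    have := norm_sub_le z x₀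
    have := le_max_left (R₀ + ‖x₀‖) 1
    linarith
  obtain ⟨w, -, hw⟩ := LowerSemicontinuousOn.exists_isMinOn (s := Metric.closedBall x₀ R) (f := f)
    ⟨x₀, by simp [hRpos.le]⟩ (isCompact_closedBall x₀ R) (hf.lsc.lowerSemicontinuousOn _)
  obtain ⟨b, -, hb⟩ := EReal.lt_iff_exists_real_btwn.1 (bot_lt_iff_ne_bot.2 (hf.ne_bot w))
  -- The maximum serves the two regions, `1 - b` inside the ball and `-m` outside; `‖x₀‖ / R` pays
  -- for moving the centre to the origin.
  refine ⟨1 / R, by positivity, max (1 - b) (-m) + ‖x₀‖ / R, fun z => ?_⟩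
  have hzn : ‖z‖ / R ≤ ‖z - x₀‖ / R + ‖x₀‖ / R := by
    rw [← add_div]
    gcongr
    simpa using norm_add_le (z - x₀) x₀
  rcases le_or_gt ‖z - x₀‖ R with hz | hz
  · have h2 : f w ≤ f z := hw (by simpa [dist_eq_norm] using hz)
    refine le_trans ?_ (hb.le.trans h2)
    rw [EReal.coe_le_coe_iff]
    have : ‖z - x₀‖ / R ≤ 1 := (div_le_one hRpos).2 hz
    have := le_max_left (1 - b) (-m)
    have : 1 / R * ‖z‖ = ‖z‖ / R := by ring
    linarith
  · set d := ‖z - x₀‖ with hd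
    have hdpos : 0 < d := hRpos.trans hz
    have ht : R / d < 1 := (div_lt_one hdpos).2 hz
    have h2 := hfar ((R / d) • z + (1 - R / d) • x₀) (by
      have : (R / d) • z + (1 - R / d) • x₀ - x₀ = (R / d) • (z - x₀) := by
        rw [smul_sub, sub_smul, one_smul]; abel
      rw [this, norm_smul, ← hd, Real.norm_of_nonneg (by positivity)]
      exact (div_mul_cancel₀ R hdpos.ne').ge)
    have h3 := fun r hr => h2.trans_le (hf.econvex z x₀ (R / d) (1 - R / d) (by positivity)
      (by linarith) (by ring) r m hr hm.symm.le)
    have hz' := hf.ne_bot z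
    generalize f z = v at *
    induction v with
    | bot => exact absurd rfl hz'
    | top => exact le_top
    | coe t =>
      have h4 := h3 t le_rfl
      rw [EReal.coe_lt_coe_iff] at h4
      rw [EReal.coe_le_coe_iff]
      have h5 : d / R ≤ t - m := by
        have : 1 < R / d * (t - m) := by linarith
        rw [div_le_iff₀ hRpos]
        rw [div_mul_eq_mul_div, lt_div_iff₀ hdpos] at this
        linarith [mul_comm R (t - m)]
      have := le_max_right (1 - b) (-m)
      have : 1 / R * ‖z‖ = ‖z‖ / R := by ring
      linarith

/-- The conjugate of a function with linear growth is bounded near the origin. -/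
theorem IsConvC.exists_legendre_le {n : ℕ} {f : Euc n → EReal} (hf : IsConvC f) :
    ∃ δ > 0, ∃ c : ℝ, ∀ y, ‖y‖ ≤ δ → legendre f y ≤ c := by
  obtain ⟨δ, hδ, c, h⟩ := hf.exists_linear_growth
  refine ⟨δ, hδ, c, fun y hy => legendre_le_coe_iff.2 fun x => le_trans ?_ (h x)⟩
  rw [EReal.coe_le_coe_iff]
  have := real_inner_le_norm y x
  have := mul_le_mul_of_nonneg_right hy (norm_nonneg x)
  linarith

theorem IsConvC.legendre_legendre {n : ℕ} {f : Euc n → EReal} (hf : IsConvC f) :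
    legendre (legendre f) = f :=
  hf.econvex.legendre_legendre hf.lsc hf.proper hf.ne_bot

/-- The conjugate of a closed proper convex function that is bounded above near the origin is
coercive. -/
theorem isConvC_legendre {n : ℕ} {h : Euc n → EReal} (hh : EConvex h)
    (hlsc : LowerSemicontinuous h) (hbot : ∀ x, h x ≠ ⊥) {δ c : ℝ} (hδ : 0 < δ)
    (hc : ∀ y, ‖y‖ ≤ δ → h y ≤ c) : IsConvC (legendre h) := by
  have hp : ∃ x, h x < ⊤ := ⟨0, (hc 0 (by simpa using hδ.le)).trans_lt (EReal.coe_lt_top c)⟩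
  refine ⟨legendre_ne_bot hp, (econvex_legendre h).le (legendre_ne_bot hp), ?_, ?_,
    lowerSemicontinuous_legendre h⟩
  · refine tendsto_top_of_linear_growth (δ := δ) (c := c) hδ fun x => ?_
    -- The point of norm `δ` in the direction of `x`; for `x = 0` it is `0` because `0⁻¹ = 0`.
    set y : Euc n := (δ * ‖x‖⁻¹) • x with hy
    have hyn : ‖y‖ ≤ δ := by
      rw [hy, norm_smul, Real.norm_of_nonneg (by positivity), mul_assoc]
      exact mul_le_of_le_one_right hδ.le (inv_mul_le_one)
    have hyi : inner ℝ x y = δ * ‖x‖ := by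
      rw [hy, real_inner_smul_right, real_inner_self_eq_norm_sq]
      rcases eq_or_ne ‖x‖ 0 with h0 | h0
      · simp [h0]
      · field_simp
    refine le_trans ?_ (le_iSup (fun y => ((inner ℝ x y : ℝ) : EReal) - h y) y)
    rw [hyi, EReal.coe_sub]
    exact EReal.sub_le_sub le_rfl (hc y hyn)
  -- A conjugate identically `⊤` would have conjugate identically `⊥`, contradicting `h** = h`.
  · by_contra! htop
    have := congrFun (hh.legendre_legendre hlsc hp hbot) 0
    refine hbot 0 (this ▸ ?_)
    rw [legendre, iSup_eq_bot]
    intro y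
    rw [top_le_iff.1 (htop y)]
    simp

/-! ### Operations on `Conv_c` -/

theorem EReal.eq_of_forall_le_coe_iff {u v : EReal} (h : ∀ c : ℝ, u ≤ c ↔ v ≤ c) : u = v := by
  refine le_antisymm (EReal.le_of_forall_lt_iff_le.1 fun c hc => ?_)
    (EReal.le_of_forall_lt_iff_le.1 fun c hc => ?_)
  · exact (h c).2 hc.le
  · exact (h c).1 hc.le

theorem EReal.coe_mul_le_coe_iff {l : ℝ} (hl : 0 < l) (u : EReal) (r : ℝ) :
    (l : EReal) * u ≤ r ↔ u ≤ ((r / l : ℝ) : EReal) := by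
  induction u with
  | bot => simp [EReal.coe_mul_bot_of_pos hl]
  | top => simp [EReal.coe_mul_top_of_pos hl]
  | coe t =>
    rw [← EReal.coe_mul, EReal.coe_le_coe_iff, EReal.coe_le_coe_iff, le_div_iff₀ hl, mul_comm]

theorem EReal.coe_lt_coe_mul_iff {l : ℝ} (hl : 0 < l) (u : EReal) (r : ℝ) :
    (r : EReal) < (l : EReal) * u ↔ ((r / l : ℝ) : EReal) < u :=
  lt_iff_lt_of_le_iff_le (EReal.coe_mul_le_coe_iff hl u r)

theorem lowerSemicontinuous_of_real {α : Type*} [TopologicalSpace α] {f : α → EReal}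
    (h : ∀ x (r : ℝ), (r : EReal) < f x → ∀ᶠ x' in 𝓝 x, (r : EReal) ≤ f x') :
    LowerSemicontinuous f := by
  intro x t ht
  obtain ⟨r, hr1, hr2⟩ := EReal.lt_iff_exists_real_btwn.1 ht
  filter_upwards [h x r hr2] with x' hx' using hr1.trans_le hx'

theorem LowerSemicontinuous.comp_cont {α β : Type*} [TopologicalSpace α] [TopologicalSpace β]
    {f : β → EReal} {g : α → β} (hf : LowerSemicontinuous f) (hg : Continuous g) :
    LowerSemicontinuous fun x => f (g x) :=
  fun x t ht => hg.continuousAt.eventually (hf (g x) t ht)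

theorem IsConvC.epiMul {n : ℕ} {f : Euc n → EReal} (hf : IsConvC f) {l : ℝ} (hl : 0 < l) :
    IsConvC (epiMul l f) := by
  have hbot : ∀ x, _root_.epiMul l f x ≠ ⊥ := by
    intro x
    have := hf.ne_bot (l⁻¹ • x)
    rw [_root_.epiMul]
    generalize f (l⁻¹ • x) = u at *
    induction u with
    | bot => exact absurd rfl this
    | top => simp [EReal.coe_mul_top_of_pos hl]
    | coe t => rw [← EReal.coe_mul]; exact EReal.coe_ne_bot _
  refine ⟨hbot, EConvex.le (fun x y a b ha hb hab r s hr hs => ?_) hbot, ?_, ?_, ?_⟩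
  · rw [_root_.epiMul, EReal.coe_mul_le_coe_iff hl] at *
    have := hf.econvex _ _ a b ha hb hab _ _ hr hs
    rw [smul_add, smul_comm _ a, smul_comm _ b]
    convert this using 2
    ring
  · obtain ⟨δ, hδ, c, h⟩ := hf.exists_linear_growth
    refine tendsto_top_of_linear_growth (δ := δ) (c := l * c) hδ fun x => ?_
    refine le_trans (le_of_eq ?_) (mul_le_mul_of_nonneg_left (h (l⁻¹ • x))
      (EReal.coe_nonneg.2 hl.le))
    rw [norm_smul, Real.norm_of_nonneg (inv_nonneg.2 hl.le), ← EReal.coe_mul]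
    congr 1
    field_simp
  · obtain ⟨x, hx⟩ := hf.proper
    refine ⟨l • x, ?_⟩
    rw [_root_.epiMul, inv_smul_smul₀ hl.ne']
    lift f x to ℝ using ⟨hx.ne, hf.ne_bot x⟩ with t
    rw [← EReal.coe_mul]
    exact EReal.coe_lt_top _
  · refine lowerSemicontinuous_of_real fun x r hr => ?_
    rw [_root_.epiMul, EReal.coe_lt_coe_mul_iff hl] at hr
    filter_upwards [(hf.lsc.comp_cont (continuous_const_smul l⁻¹)) x _ hr] with x' hx'
    exact ((EReal.coe_lt_coe_mul_iff hl _ _).2 hx').le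

theorem legendre_epiMul {n : ℕ} (f : Euc n → EReal) {l : ℝ} (hl : 0 < l) (y : Euc n) :
    legendre (epiMul l f) y = (l : EReal) * legendre f y := by
  refine EReal.eq_of_forall_le_coe_iff fun c => ?_
  rw [EReal.coe_mul_le_coe_iff hl, legendre_le_coe_iff, legendre_le_coe_iff]
  have key : ∀ x, ((inner ℝ y (l • x) - c : ℝ) : EReal) ≤ epiMul l f (l • x) ↔
      ((inner ℝ y x - c / l : ℝ) : EReal) ≤ f x := by
    intro x
    rw [epiMul, inv_smul_smul₀ hl.ne', ← not_lt, ← not_lt, not_iff_not]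
    have h1 : inner ℝ y (l • x) - c = l * (inner ℝ y x - c / l) := by
      rw [real_inner_smul_right]; field_simp
    rw [h1]
    generalize inner ℝ y x - c / l = p
    generalize f x = u
    induction u with
    | bot =>
      rw [EReal.coe_mul_bot_of_pos hl]
      simp only [EReal.bot_lt_coe]
    | top => simp [EReal.coe_mul_top_of_pos hl]
    | coe t =>
      rw [← EReal.coe_mul, EReal.coe_lt_coe_iff, EReal.coe_lt_coe_iff, mul_lt_mul_iff_right₀ hl]
  constructor
  · intro h x
    exact (key x).1 (h _)
  · intro h x
    have := (key (l⁻¹ • x)).2 (h _)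
    rwa [smul_inv_smul₀ hl.ne'] at this

/-! ### Infimal convolution in `Conv_c` -/

section InfConv

variable {n : ℕ} {f g : Euc n → EReal}

/-- Joint growth confines the relevant `y` to a ball that does not depend on `x`; attainment and
lower semicontinuity of the infimum both follow from this compactness. -/
theorem infConv_growth (hf : IsConvC f) (hg : IsConvC g) :
    ∃ δ > 0, ∃ c : ℝ, ∀ x y, ((δ * (‖x - y‖ + ‖y‖) - c : ℝ) : EReal) ≤ f (x - y) + g y := by
  obtain ⟨δ₁, h1, c₁, hf'⟩ := hf.exists_linear_growth
  obtain ⟨δ₂, h2, c₂, hg'⟩ := hg.exists_linear_growth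
  refine ⟨min δ₁ δ₂, lt_min h1 h2, c₁ + c₂, fun x y => ?_⟩
  refine le_trans ?_ (add_le_add (hf' (x - y)) (hg' y))
  rw [← EReal.coe_add, EReal.coe_le_coe_iff]
  have := mul_le_mul_of_nonneg_right (min_le_left δ₁ δ₂) (norm_nonneg (x - y))
  have := mul_le_mul_of_nonneg_right (min_le_right δ₁ δ₂) (norm_nonneg y)
  linarith

theorem lowerSemicontinuous_infConv_integrand (hf : IsConvC f) (hg : IsConvC g) :
    LowerSemicontinuous fun p : Euc n × Euc n => f (p.1 - p.2) + g p.2 :=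
  (hf.lsc.comp_cont (continuous_fst.sub continuous_snd)).add' (hg.lsc.comp_cont continuous_snd)
    fun _ => EReal.continuousAt_add (Or.inr (hg.ne_bot _)) (Or.inl (hf.ne_bot _))

theorem exists_infConv_eq (hf : IsConvC f) (hg : IsConvC g) (x : Euc n) :
    ∃ y, infConv f g x = f (x - y) + g y := by
  rcases eq_or_ne (infConv f g x) ⊤ with htop | htop
  · exact ⟨0, htop.trans (iInf_eq_top.1 htop 0).symm⟩
  obtain ⟨δ, hδ, c, h⟩ := infConv_growth hf hg
  obtain ⟨r, hr, -⟩ := EReal.lt_iff_exists_real_btwn.1 (lt_top_iff_ne_top.2 htop)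
  obtain ⟨y₀, hy₀⟩ := iInf_lt_iff.1 hr
  have hfar : ∀ y, f (x - y) + g y < r → y ∈ Metric.closedBall (0 : Euc n) ((r + c) / δ) := by
    intro y hy
    have := (h x y).trans_lt hy
    rw [EReal.coe_lt_coe_iff] at this
    rw [mem_closedBall_zero_iff, le_div_iff₀ hδ]
    have := mul_nonneg hδ.le (norm_nonneg (x - y))
    linarith
  have hl : LowerSemicontinuous fun y => f (x - y) + g y :=
    (lowerSemicontinuous_infConv_integrand hf hg).comp_cont (g := fun y => (x, y)) (by fun_prop)
  obtain ⟨w, hwm, hw⟩ := LowerSemicontinuousOn.exists_isMinOn ⟨y₀, hfar y₀ hy₀⟩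
    (isCompact_closedBall (0 : Euc n) ((r + c) / δ)) (hl.lowerSemicontinuousOn _)
  refine ⟨w, le_antisymm (iInf_le _ w) (le_iInf fun y => ?_)⟩
  rcases lt_or_ge (f (x - y) + g y) r with hy | hy
  · exact hw (hfar y hy)
  · exact (hw (hfar y₀ hy₀)).trans (hy₀.le.trans hy)

theorem IsConvC.infConv (hf : IsConvC f) (hg : IsConvC g) : IsConvC (infConv f g) := by
  obtain ⟨δ, hδ, c, h⟩ := infConv_growth hf hg
  have hgrow : ∀ x, ((δ * ‖x‖ - c : ℝ) : EReal) ≤ _root_.infConv f g x := by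
    refine fun x => le_iInf fun y => le_trans ?_ (h x y)
    rw [EReal.coe_le_coe_iff]
    have : ‖x‖ ≤ ‖x - y‖ + ‖y‖ := by simpa using norm_add_le (x - y) y
    have := mul_le_mul_of_nonneg_left this hδ.le
    linarith
  have hbot : ∀ x, _root_.infConv f g x ≠ ⊥ := fun x hx => by
    have := hx ▸ hgrow x
    exact EReal.coe_ne_bot _ (le_bot_iff.1 this)
  refine ⟨hbot, EConvex.le (fun x x' a b ha hb hab r s hr hs => ?_) hbot,
    tendsto_top_of_linear_growth hδ hgrow, ?_, ?_⟩
  · obtain ⟨y, hy⟩ := exists_infConv_eq hf hg x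
    obtain ⟨y', hy'⟩ := exists_infConv_eq hf hg x'
    refine (iInf_le _ (a • y + b • y')).trans ?_
    rw [hy] at hr
    rw [hy'] at hs
    have e : a • x + b • x' - (a • y + b • y') = a • (x - y) + b • (x' - y') := by
      rw [smul_sub, smul_sub]; abel
    rw [e]
    have real : ∀ u v, f (u - v) + g v < ⊤ → ∃ p q : ℝ, f (u - v) = p ∧ g v = q := by
      intro u v huv
      have h1 := hf.ne_bot (u - v)
      have h2 := hg.ne_bot v
      refine ⟨(f (u - v)).toReal, (g v).toReal, (EReal.coe_toReal ?_ h1).symm,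
        (EReal.coe_toReal ?_ h2).symm⟩
      · intro ht
        rw [ht, EReal.top_add_of_ne_bot h2] at huv
        exact lt_irrefl _ huv
      · intro ht
        rw [ht, EReal.add_top_of_ne_bot h1] at huv
        exact lt_irrefl _ huv
    obtain ⟨p, q, hp, hq⟩ := real x y (hr.trans_lt (EReal.coe_lt_top _))
    obtain ⟨p', q', hp', hq'⟩ := real x' y' (hs.trans_lt (EReal.coe_lt_top _))
    have h1 := hf.econvex _ _ a b ha hb hab p p' hp.le hp'.le
    have h2 := hg.econvex _ _ a b ha hb hab q q' hq.le hq'.le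
    refine (add_le_add h1 h2).trans ?_
    rw [hp, hq, ← EReal.coe_add, EReal.coe_le_coe_iff] at hr
    rw [hp', hq', ← EReal.coe_add, EReal.coe_le_coe_iff] at hs
    rw [← EReal.coe_add, EReal.coe_le_coe_iff]
    nlinarith
  · obtain ⟨x, hx⟩ := hf.proper
    obtain ⟨y, hy⟩ := hg.proper
    refine ⟨x + y, (iInf_le _ y).trans_lt ?_⟩
    rw [add_sub_cancel_right]
    exact EReal.add_lt_top hx.ne hy.ne
  · refine lowerSemicontinuous_of_real fun x r hr => ?_
    -- On the ball, joint lower semicontinuity and compactness give one neighbourhood of `x` for all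
    -- `y`; off the ball the growth bound alone exceeds `r`.
    have hK := IsCompact.eventually_forall_of_forall_eventually (x₀ := x)
      (P := fun x' y => (r : EReal) < f (x' - y) + g y)
      (isCompact_closedBall (0 : Euc n) ((r + c) / δ))
      (fun y _ => lowerSemicontinuous_infConv_integrand hf hg (x, y) r
        (hr.trans_le (iInf_le _ y)))
    filter_upwards [hK] with x' hx'
    refine le_iInf fun y => ?_
    by_cases hy : y ∈ Metric.closedBall (0 : Euc n) ((r + c) / δ)
    · exact (hx' y hy).le
    · refine le_trans ?_ (h x' y)
      rw [mem_closedBall_zero_iff, not_le, div_lt_iff₀ hδ] at hy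
      rw [EReal.coe_le_coe_iff]
      have := mul_nonneg hδ.le (norm_nonneg (x' - y))
      linarith

/-- The supremum splits over the independent variables `x - y` and `y`. Properness excludes `⊥`, so
a finite bound on the sum makes both conjugates real. -/
theorem legendre_infConv (hf : IsConvC f) (hg : IsConvC g) (y : Euc n) :
    legendre (infConv f g) y = legendre f y + legendre g y := by
  refine EReal.eq_of_forall_le_coe_iff fun c => ?_
  have hFb := legendre_ne_bot hf.proper y
  have hGb := legendre_ne_bot hg.proper y
  rw [legendre_le_coe_iff]
  constructor
  · intro h
    have h' : ∀ u w, ((inner ℝ y u + inner ℝ y w - c : ℝ) : EReal) ≤ f u + g w := by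
      intro u w
      have := (h (u + w)).trans (iInf_le _ w)
      rwa [inner_add_right, add_sub_cancel_right] at this
    have step : ∀ w (q : ℝ), g w = q → legendre f y ≤ ((c - inner ℝ y w + q : ℝ) : EReal) := by
      intro w q hq
      rw [legendre_le_coe_iff]
      intro u
      have := h' u w
      rw [hq] at this
      have hu := hf.ne_bot u
      generalize f u = v at *
      induction v with
      | bot => exact absurd rfl hu
      | top => exact le_top
      | coe p =>
        rw [← EReal.coe_add, EReal.coe_le_coe_iff] at this
        rw [EReal.coe_le_coe_iff]
        linarith
    obtain ⟨w₀, hw₀⟩ := hg.proper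
    have hFt : legendre f y ≠ ⊤ := by
      have := step w₀ _ (EReal.coe_toReal hw₀.ne (hg.ne_bot w₀)).symm
      exact (this.trans_lt (EReal.coe_lt_top _)).ne
    lift legendre f y to ℝ using ⟨hFt, hFb⟩ with A
    have hG : legendre g y ≤ ((c - A : ℝ) : EReal) := by
      rw [legendre_le_coe_iff]
      intro w
      have hw := hg.ne_bot w
      have hs := step w
      generalize g w = v at *
      induction v with
      | bot => exact absurd rfl hw
      | top => exact le_top
      | coe q =>
        have := hs q rfl
        rw [EReal.coe_le_coe_iff] at *
        linarith
    refine (add_le_add le_rfl hG).trans (le_of_eq ?_)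
    rw [← EReal.coe_add]
    congr 1
    ring
  · intro h x
    have hlt := h.trans_lt (EReal.coe_lt_top c)
    have hFt : legendre f y ≠ ⊤ := fun ht => by
      rw [ht, EReal.top_add_of_ne_bot hGb] at hlt; exact lt_irrefl _ hlt
    have hGt : legendre g y ≠ ⊤ := fun ht => by
      rw [ht, EReal.add_top_of_ne_bot hFb] at hlt; exact lt_irrefl _ hlt
    obtain ⟨A, hA⟩ : ∃ A : ℝ, legendre f y = A := ⟨_, (EReal.coe_toReal hFt hFb).symm⟩
    obtain ⟨B, hB⟩ : ∃ B : ℝ, legendre g y = B := ⟨_, (EReal.coe_toReal hGt hGb).symm⟩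
    rw [hA, hB, ← EReal.coe_add, EReal.coe_le_coe_iff] at h
    refine le_iInf fun w => ?_
    refine le_trans ?_ (add_le_add (legendre_le_coe_iff.1 hA.le (x - w))
      (legendre_le_coe_iff.1 hB.le w))
    rw [← EReal.coe_add, EReal.coe_le_coe_iff, inner_sub_right]
    linarith

end InfConv

/-! ### Suprema of affine functions and outer linearizations -/

/-- The supremum of the affine functions `x ↦ ⟨x, v i⟩ - a i`. -/
noncomputable def affSup {n : ℕ} {ι : Type*} (v : ι → Euc n) (a : ι → ℝ) (x : Euc n) : EReal :=
  ⨆ i, ((inner ℝ x (v i) - a i : ℝ) : EReal)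

/-- The vectors `v i` positively span the space, in a quantitative form. -/
def SpansPos {n : ℕ} {ι : Type*} (v : ι → Euc n) : Prop :=
  ∃ δ > 0, ∀ x, ∃ i, δ * ‖x‖ ≤ inner ℝ x (v i)

theorem isConvC_affSup {n : ℕ} {ι : Type*} {v : ι → Euc n} {a : ι → ℝ} {δ c : ℝ} (hδ : 0 < δ)
    (h : ∀ x, ∃ i, δ * ‖x‖ - c ≤ inner ℝ x (v i) - a i) (hp : ∃ x, affSup v a x < ⊤) :
    IsConvC (affSup v a) := by
  have hgrow : ∀ x, ((δ * ‖x‖ - c : ℝ) : EReal) ≤ affSup v a x := by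
    intro x
    obtain ⟨i, hi⟩ := h x
    exact (EReal.coe_le_coe_iff.2 hi).trans
      (le_iSup (fun i => ((inner ℝ x (v i) - a i : ℝ) : EReal)) i)
  have hbot : ∀ x, affSup v a x ≠ ⊥ := fun x hx => by
    have := hx ▸ hgrow x
    exact EReal.coe_ne_bot _ (le_bot_iff.1 this)
  refine ⟨hbot, EConvex.le (fun x y s t hs ht hst r r' hr hr' => ?_) hbot,
    tendsto_top_of_linear_growth hδ hgrow, hp, ?_⟩
  · simp only [affSup, iSup_le_iff, EReal.coe_le_coe_iff] at *
    intro i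
    have h1 := hr i
    have h2 := hr' i
    rw [inner_add_left, real_inner_smul_left, real_inner_smul_left]
    have : a i = s * a i + t * a i := by rw [← add_mul, hst, one_mul]
    rw [this]
    nlinarith
  · refine lowerSemicontinuous_iSup fun i => Continuous.lowerSemicontinuous ?_
    exact continuous_coe_real_ereal.comp (by fun_prop)

theorem isConvC_affSup_of_fintype {n : ℕ} {ι : Type*} [Fintype ι] {v : ι → Euc n}
    (hv : SpansPos v) (a : ι → ℝ) : IsConvC (affSup v a) := by
  obtain ⟨δ, hδ, h⟩ := hv
  refine isConvC_affSup (c := ∑ i, |a i|) hδ (fun x => ?_) ⟨0, ?_⟩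
  · obtain ⟨i, hi⟩ := h x
    refine ⟨i, sub_le_sub hi ((le_abs_self _).trans ?_)⟩
    exact Finset.single_le_sum (f := fun i => |a i|) (fun j _ => abs_nonneg _) (Finset.mem_univ i)
  · refine lt_of_le_of_lt (iSup_le fun i => ?_) (EReal.coe_lt_top (∑ i, |a i|))
    rw [EReal.coe_le_coe_iff, inner_zero_left, zero_sub]
    exact (neg_le_abs _).trans
      (Finset.single_le_sum (f := fun i => |a i|) (fun j _ => abs_nonneg _) (Finset.mem_univ i))

/-- A set with positive hull the whole space has a finite subset that spans positively. -/
theorem exists_finset_spansPos {n : ℕ} (hn : 1 ≤ n) {Y : Set (Euc n)}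
    (hY : PointedCone.hull ℝ Y = ⊤) :
    ∃ F : Finset (Euc n), (F : Set (Euc n)) ⊆ Y ∧ SpansPos fun y : F => (y : Euc n) := by
  have : Nonempty (Fin n) := ⟨⟨0, hn⟩⟩
  -- A vector `x` with `⟨x, ·⟩ ≤ 0` on `Y` has the same property on the hull, which contains `x`
  -- itself.
  have hpos : ∀ x : Euc n, x ≠ 0 → ∃ y ∈ Y, 0 < inner ℝ x y := by
    intro x hx
    by_contra! hcon
    have hall : ∀ z ∈ PointedCone.hull ℝ Y, inner ℝ x z ≤ 0 := by
      intro z hz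
      induction hz using Submodule.span_induction with
      | mem z hz => exact hcon z hz
      | zero => simp
      | add u w _ _ hu hw => rw [inner_add_right]; linarith
      | smul t u _ hu =>
        have : t • u = (t : ℝ) • u := rfl
        rw [this, real_inner_smul_right]
        exact mul_nonpos_of_nonneg_of_nonpos t.2 hu
    have := hall x (hY ▸ Submodule.mem_top)
    rw [real_inner_self_eq_norm_sq] at this
    exact absurd this (not_le.2 (by positivity))
  -- The natural number in the index records a positive threshold, so a finite subcover yields a
  -- uniform one.
  obtain ⟨T, hT⟩ := (isCompact_sphere (0 : Euc n) 1).elim_finite_subcover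
    (fun p : Y × ℕ => {x : Euc n | 1 / ((p.2 : ℝ) + 1) < inner ℝ x (p.1 : Euc n)})
    (fun p => isOpen_lt continuous_const (by fun_prop)) (by
      intro x hx
      have hx0 : x ≠ 0 := by
        rintro rfl
        simp at hx
      obtain ⟨y, hy, hxy⟩ := hpos x hx0
      obtain ⟨k, hk⟩ := exists_nat_one_div_lt hxy
      exact Set.mem_iUnion.2 ⟨(⟨y, hy⟩, k), hk⟩)
  classical
  obtain ⟨N, hN⟩ : ∃ N : ℕ, ∀ p ∈ T, p.2 ≤ N :=
    ⟨T.sup Prod.snd, fun p hp => Finset.le_sup (f := Prod.snd) hp⟩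
  have hsph : ∀ x : Euc n, ‖x‖ = 1 → ∃ p ∈ T, 1 / ((N : ℝ) + 1) ≤ inner ℝ x (p.1 : Euc n) := by
    intro x hx
    obtain ⟨p, hp, hxp⟩ := Set.mem_iUnion₂.1 (hT (mem_sphere_zero_iff_norm.2 hx))
    refine ⟨p, hp, le_trans ?_ (le_of_lt hxp)⟩
    have : (p.2 : ℝ) ≤ N := by exact_mod_cast hN p hp
    gcongr
  refine ⟨T.image fun p => (p.1 : Euc n), ?_, 1 / ((N : ℝ) + 1), by positivity, fun x => ?_⟩
  · intro y hy
    obtain ⟨p, -, rfl⟩ := Finset.mem_image.1 (Finset.mem_coe.1 hy)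
    exact p.1.2
  · rcases eq_or_ne x 0 with rfl | hx
    · obtain ⟨e, he⟩ := exists_norm_eq (Euc n) zero_le_one
      obtain ⟨p, hp, -⟩ := hsph e he
      exact ⟨⟨p.1, Finset.mem_image_of_mem _ hp⟩, by simp⟩
    · obtain ⟨p, hp, h⟩ := hsph (‖x‖⁻¹ • x) (by
        rw [norm_smul, norm_inv, norm_norm, inv_mul_cancel₀ (norm_ne_zero_iff.2 hx)])
      refine ⟨⟨p.1, Finset.mem_image_of_mem _ hp⟩, ?_⟩
      have hx' := norm_pos_iff.2 hx
      rw [real_inner_smul_left, ← div_eq_inv_mul, le_div_iff₀ hx'] at h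
      exact h

theorem slopeConst_eq {n : ℕ} (ψ : Euc n → EReal) (y : Euc n) :
    slopeConst ψ y = -legendre ψ y := by
  have key : ∀ c : ℝ, (∀ x : Euc n, ((inner ℝ x y + c : ℝ) : EReal) ≤ ψ x) ↔
      (c : EReal) ≤ -legendre ψ y := by
    intro c
    rw [EReal.le_neg, ← EReal.coe_neg, legendre_le_coe_iff]
    simp only [real_inner_comm, sub_neg_eq_add]
  rw [slopeConst]
  simp only [key]
  refine le_antisymm (iSup₂_le fun c hc => hc) ?_
  rw [← EReal.ge_of_forall_gt_iff_ge]
  intro c hc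
  exact le_iSup₂ (f := fun (c : ℝ) (_ : (c : EReal) ≤ -legendre ψ y) => (c : EReal)) c hc.le

/-- Slopes where the conjugate is `⊤` contribute `-∞` and can be dropped, which leaves real
intercepts. -/
theorem outerLin_eq {n : ℕ} {ψ : Euc n → EReal} (hp : ∃ x, ψ x < ⊤) (Y : Set (Euc n)) :
    outerLin ψ Y = affSup (fun y : {y // y ∈ Y ∧ legendre ψ y < ⊤} => (y : Euc n))
      fun y => (legendre ψ y).toReal := by
  funext x
  simp only [outerLin, affSup, maxAffine, slopeConst_eq]
  have key : ∀ y, legendre ψ y < ⊤ → ((inner ℝ x y : ℝ) : EReal) + -legendre ψ y =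
      ((inner ℝ x y - (legendre ψ y).toReal : ℝ) : EReal) := by
    intro y hy
    lift legendre ψ y to ℝ using ⟨hy.ne, legendre_ne_bot hp y⟩ with c
    rw [EReal.toReal_coe, EReal.coe_sub, sub_eq_add_neg]
  refine le_antisymm (iSup₂_le fun y hy => ?_) (iSup_le fun y => ?_)
  · rcases eq_or_ne (legendre ψ y) ⊤ with h | h
    · simp [h]
    · rw [key y (lt_top_iff_ne_top.2 h)]
      exact le_iSup (fun y : {y // y ∈ Y ∧ legendre ψ y < ⊤} =>
        ((inner ℝ x (y : Euc n) - (legendre ψ y).toReal : ℝ) : EReal))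
        ⟨y, hy, lt_top_iff_ne_top.2 h⟩
  · rw [← key y y.2.2]
    exact le_iSup₂ (f := fun y (_ : y ∈ Y) => ((inner ℝ x y : ℝ) : EReal) + -legendre ψ y)
      (y : Euc n) y.2.1

theorem outerLin_le {n : ℕ} {ψ : Euc n → EReal} (hp : ∃ x, ψ x < ⊤) (Y : Set (Euc n))
    (x : Euc n) : outerLin ψ Y x ≤ ψ x := by
  rw [outerLin_eq hp]
  refine iSup_le fun y => ?_
  have := (EReal.coe_toReal y.2.2.ne (legendre_ne_bot hp y)).symm.le
  rw [real_inner_comm]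
  exact legendre_le_coe_iff.1 this x

theorem IsConvC.outerLin {n : ℕ} {ψ : Euc n → EReal} (hψ : IsConvC ψ) (hn : 1 ≤ n)
    {Y Y₀ : Set (Euc n)} (hY : Y₀ ⊆ Y) (hpos : PointedCone.hull ℝ Y₀ = ⊤)
    (hfin : ∀ y ∈ Y₀, legendre ψ y < ⊤) : IsConvC (outerLin ψ Y) := by
  obtain ⟨F, hF, δ, hδ, h⟩ := exists_finset_spansPos hn hpos
  obtain ⟨x₀, hx₀⟩ := hψ.proper
  have hle := outerLin_le hψ.proper Y x₀
  rw [outerLin_eq hψ.proper] at hle ⊢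
  refine isConvC_affSup (c := ∑ i ∈ F, |(legendre ψ i).toReal|) hδ (fun x => ?_)
    ⟨x₀, hle.trans_lt hx₀⟩
  obtain ⟨y, hy⟩ := h x
  refine ⟨⟨y, hY (hF y.2), hfin y (hF y.2)⟩, sub_le_sub hy ((le_abs_self _).trans ?_)⟩
  exact Finset.single_le_sum (f := fun y => |(legendre ψ y).toReal|) (fun j _ => abs_nonneg _) y.2

/-! ### Integrals of extended-real-valued functions -/

section EIntegral

variable {α : Type*} [MeasurableSpace α] {μ : Measure α} [IsProbabilityMeasure μ] {f : α → EReal}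

/-- Integrate `(f + M) + f⁻ = f⁺ + M`, all terms nonnegative. The integral of `f⁻` is at most `M`,
hence can be subtracted, and one Lebesgue integral replaces a difference. -/
theorem eintegral_eq_shift (hf : Measurable f) {M : ℝ} (hM : 0 ≤ M)
    (hfM : ∀ a, ((-M : ℝ) : EReal) ≤ f a) :
    eintegral μ f = ((∫⁻ a, (f a + (M : EReal)).toENNReal ∂μ : ℝ≥0∞) : EReal) - (M : EReal) := by
  have hpt : ∀ a, (f a + (M : EReal)).toENNReal + (-f a).toENNReal =
      (f a).toENNReal + ENNReal.ofReal M := by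
    intro a
    have := hfM a
    generalize f a = u at *
    induction u with
    | bot => simp at this
    | top => simp
    | coe t =>
      rw [EReal.coe_le_coe_iff] at this
      rw [← EReal.coe_add, ← EReal.coe_neg]
      simp only [EReal.real_coe_toENNReal]
      rcases le_total 0 t with h | h
      · rw [ENNReal.ofReal_of_nonpos (neg_nonpos.2 h), add_zero, ENNReal.ofReal_add h hM]
      · rw [ENNReal.ofReal_of_nonpos h, zero_add, ← ENNReal.ofReal_add (by linarith) (by linarith)]
        congr 1
        ring
  have hint := lintegral_congr (μ := μ) hpt
  rw [lintegral_add_left (by fun_prop), lintegral_add_left (by fun_prop), lintegral_const,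
    measure_univ, mul_one] at hint
  have hN : (∫⁻ a, (-f a).toENNReal ∂μ) ≠ ⊤ := by
    refine ne_top_of_le_ne_top (b := ∫⁻ _, ENNReal.ofReal M ∂μ) (by simp) (lintegral_mono fun a => ?_)
    have h1 : -f a ≤ (M : EReal) := by
      rw [EReal.neg_le, ← EReal.coe_neg]
      exact hfM a
    simpa using EReal.toENNReal_le_toENNReal h1
  rw [eintegral]
  generalize (∫⁻ a, (-f a).toENNReal ∂μ) = N at *
  generalize (∫⁻ a, (f a).toENNReal ∂μ) = P at *
  generalize (∫⁻ a, (f a + (M : EReal)).toENNReal ∂μ) = I at *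
  lift N to ℝ≥0 using hN
  have hE : (I : EReal) + ((N : ℝ≥0∞) : EReal) = (P : EReal) + (M : EReal) := by
    have := congrArg (fun x : ℝ≥0∞ => (x : EReal)) hint
    simp only [EReal.coe_ennreal_add] at this
    rwa [EReal.coe_ennreal_ofReal, max_eq_left hM] at this
  have hNr : ((N : ℝ≥0∞) : EReal) = ((N : ℝ) : EReal) := rfl
  rw [hNr] at hE ⊢
  induction P with
  | top =>
    induction I with
    | top => simp
    | coe I =>
      exfalso
      have hIr : ((I : ℝ≥0∞) : EReal) = ((I : ℝ) : EReal) := rfl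
      rw [hIr, ← EReal.coe_add] at hE
      simp at hE
      exact EReal.coe_ne_top _ hE
  | coe P =>
    have hPr : ((P : ℝ≥0∞) : EReal) = ((P : ℝ) : EReal) := rfl
    rw [hPr, ← EReal.coe_add] at hE
    induction I with
    | top => simp at hE; exact absurd hE.symm (EReal.coe_ne_top _)
    | coe I =>
      have hIr : ((I : ℝ≥0∞) : EReal) = ((I : ℝ) : EReal) := rfl
      rw [hIr, ← EReal.coe_add, EReal.coe_eq_coe_iff] at hE
      rw [hPr, hIr, ← EReal.coe_sub, ← EReal.coe_sub, EReal.coe_eq_coe_iff]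
      linarith

theorem eintegral_le_coe_iff (hf : Measurable f) {M : ℝ} (hM : 0 ≤ M)
    (hfM : ∀ a, ((-M : ℝ) : EReal) ≤ f a) (r : ℝ) :
    eintegral μ f ≤ (r : EReal) ↔
      ((∫⁻ a, (f a + (M : EReal)).toENNReal ∂μ : ℝ≥0∞) : EReal) ≤ ((r + M : ℝ) : EReal) := by
  rw [eintegral_eq_shift hf hM hfM, EReal.coe_add]
  exact EReal.sub_le_iff_le_add (Or.inl (EReal.coe_ne_bot _)) (Or.inl (EReal.coe_ne_top _))

theorem eintegral_ne_bot (hf : Measurable f) {M : ℝ} (hM : 0 ≤ M)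
    (hfM : ∀ a, ((-M : ℝ) : EReal) ≤ f a) : eintegral μ f ≠ ⊥ := by
  intro h
  have h1 := (eintegral_le_coe_iff (μ := μ) hf hM hfM (-M - 1)).1 (h ▸ bot_le)
  have h2 := (EReal.coe_ennreal_nonneg _).trans h1
  rw [← EReal.coe_zero, EReal.coe_le_coe_iff] at h2
  linarith

theorem eintegral_eq_integral (hf : Measurable f) {M : ℝ} (hM : 0 ≤ M)
    (hfM : ∀ a, ((-M : ℝ) : EReal) ≤ f a) (hlt : eintegral μ f < ⊤) :
    (∀ᵐ a ∂μ, f a < ⊤) ∧ Integrable (fun a => (f a).toReal) μ ∧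
      eintegral μ f = ((∫ a, (f a).toReal ∂μ : ℝ) : EReal) := by
  have hmeas : Measurable fun a => (f a + (M : EReal)).toENNReal :=
    (hf.add_const _).ereal_toENNReal
  have hI : (∫⁻ a, (f a + (M : EReal)).toENNReal ∂μ) ≠ ⊤ := by
    intro h
    rw [eintegral_eq_shift hf hM hfM, h] at hlt
    simp at hlt
  have hae : ∀ᵐ a ∂μ, f a < ⊤ := by
    filter_upwards [ae_lt_top hmeas hI] with a ha
    refine lt_top_iff_ne_top.2 fun h => ?_
    simp [h] at ha
  have hae2 : (fun a => (f a).toReal) =ᵐ[μ] fun a => (f a + (M : EReal)).toENNReal.toReal - M := by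
    filter_upwards [hae] with a ha
    have := hfM a
    lift f a to ℝ using ⟨ha.ne, fun h => by simp [h] at this⟩ with t
    rw [EReal.coe_le_coe_iff] at this
    rw [← EReal.coe_add, EReal.real_coe_toENNReal, ENNReal.toReal_ofReal (by linarith),
      EReal.toReal_coe]
    ring
  have hint := integrable_toReal_of_lintegral_ne_top hmeas.aemeasurable hI
  refine ⟨hae, (hint.sub (integrable_const M)).congr hae2.symm, ?_⟩
  rw [integral_congr_ae hae2, integral_sub hint (integrable_const M),
    integral_toReal hmeas.aemeasurable (ae_lt_top hmeas hI), eintegral_eq_shift hf hM hfM]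
  simp only [integral_const, probReal_univ, one_smul]
  lift (∫⁻ a, (f a + (M : EReal)).toENNReal ∂μ) to ℝ≥0 using hI with I
  rfl

theorem eintegral_le_integral (hf : Measurable f) {M : ℝ} (hM : 0 ≤ M)
    (hfM : ∀ a, ((-M : ℝ) : EReal) ≤ f a) {g : α → ℝ} (hg : Integrable g μ)
    (hfg : ∀ᵐ a ∂μ, f a ≤ (g a : EReal)) : eintegral μ f ≤ ((∫ a, g a ∂μ : ℝ) : EReal) := by
  rw [eintegral_le_coe_iff hf hM hfM]
  have hpos : 0 ≤ᵐ[μ] fun a => g a + M := by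
    filter_upwards [hfg] with a ha
    have := (hfM a).trans ha
    rw [EReal.coe_le_coe_iff] at this
    simp only [Pi.zero_apply]
    linarith
  have h1 : (∫⁻ a, (f a + (M : EReal)).toENNReal ∂μ) ≤ ENNReal.ofReal (∫ a, g a + M ∂μ) := by
    rw [ofReal_integral_eq_lintegral_ofReal (f := fun a => g a + M) (hg.add (integrable_const M))
      hpos]
    refine lintegral_mono_ae ?_
    filter_upwards [hfg] with a ha
    rw [← EReal.real_coe_toENNReal, EReal.coe_add]
    exact EReal.toENNReal_le_toENNReal (add_le_add ha le_rfl)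
  refine (EReal.coe_ennreal_le_coe_ennreal_iff.2 h1).trans ?_
  rw [EReal.coe_ennreal_ofReal, max_eq_left (integral_nonneg_of_ae hpos),
    integral_add hg (integrable_const M)]
  simp

end EIntegral

/-! ### Rotations -/

section Rotations

variable {n : ℕ}

/-- The action of an orthogonal matrix on `ℝⁿ`. -/
noncomputable def orthAct (ϑ : On n) (x : Euc n) : Euc n :=
  Matrix.toEuclideanLin (ϑ : Matrix (Fin n) (Fin n) ℝ) x

theorem rotated_eq (f : Euc n → EReal) (ϑ : On n) (x : Euc n) :
    rotated f ϑ x = f (orthAct ϑ⁻¹ x) := rfl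

theorem orthAct_mul (ϑ η : On n) (x : Euc n) : orthAct (ϑ * η) x = orthAct ϑ (orthAct η x) := by
  simp [orthAct, Matrix.toLpLin_apply]

theorem orthAct_one (x : Euc n) : orthAct (1 : On n) x = x := by
  simp [orthAct]

theorem orthAct_inv_orthAct (ϑ : On n) (x : Euc n) : orthAct ϑ⁻¹ (orthAct ϑ x) = x := by
  rw [← orthAct_mul, inv_mul_cancel, orthAct_one]

theorem orthAct_orthAct_inv (ϑ : On n) (x : Euc n) : orthAct ϑ (orthAct ϑ⁻¹ x) = x := by
  rw [← orthAct_mul, mul_inv_cancel, orthAct_one]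

theorem orthAct_lin (ϑ : On n) (a b : ℝ) (x y : Euc n) :
    orthAct ϑ (a • x + b • y) = a • orthAct ϑ x + b • orthAct ϑ y := by
  simp [orthAct]

theorem inner_orthAct_left (ϑ : On n) (x y : Euc n) :
    inner ℝ (orthAct ϑ x) y = inner ℝ x (orthAct ϑ⁻¹ y) := by
  have : ((ϑ⁻¹ : On n) : Matrix (Fin n) (Fin n) ℝ) =
      (ϑ : Matrix (Fin n) (Fin n) ℝ).transpose := rfl
  rw [orthAct, orthAct, this]
  simp [PiLp.inner_apply, Matrix.toLpLin_apply, Matrix.mulVec, dotProduct, Finset.sum_mul,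
    Finset.mul_sum]
  rw [Finset.sum_comm]
  exact Finset.sum_congr rfl fun i _ => Finset.sum_congr rfl fun j _ => by ring

theorem norm_orthAct (ϑ : On n) (x : Euc n) : ‖orthAct ϑ x‖ = ‖x‖ := by
  have : ‖orthAct ϑ x‖ ^ 2 = ‖x‖ ^ 2 := by
    rw [← real_inner_self_eq_norm_sq, inner_orthAct_left, orthAct_inv_orthAct,
      real_inner_self_eq_norm_sq]
  exact (sq_eq_sq₀ (norm_nonneg _) (norm_nonneg _)).1 this

theorem continuous_orthAct (ϑ : On n) : Continuous (orthAct ϑ) :=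
  LinearMap.continuous_of_finiteDimensional
    (Matrix.toEuclideanLin (ϑ : Matrix (Fin n) (Fin n) ℝ))

theorem continuous_orthAct_inv_left (x : Euc n) :
    Continuous fun ϑ : SOn n => orthAct ((ϑ : On n)⁻¹) x := by
  have h : Continuous fun A : Matrix (Fin n) (Fin n) ℝ => Matrix.toEuclideanLin A x := by
    simp only [Matrix.toLpLin_apply]
    fun_prop
  exact h.comp (continuous_subtype_val.comp (continuous_subtype_val.inv))

theorem IsConvC.rotated {f : Euc n → EReal} (hf : IsConvC f) (ϑ : On n) :
    IsConvC (rotated f ϑ) := by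
  refine ⟨fun x => hf.ne_bot _, fun x y a b ha hb hab => ?_, ?_, ?_,
    hf.lsc.comp_cont (continuous_orthAct ϑ⁻¹)⟩
  · simp only [rotated_eq, orthAct_lin]
    exact hf.convex _ _ a b ha hb hab
  · obtain ⟨δ, hδ, c, h⟩ := hf.exists_linear_growth
    refine tendsto_top_of_linear_growth (c := c) hδ fun x => ?_
    have := h (orthAct ϑ⁻¹ x)
    rwa [norm_orthAct] at this
  · obtain ⟨x, hx⟩ := hf.proper
    exact ⟨orthAct ϑ x, by rwa [rotated_eq, orthAct_inv_orthAct]⟩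

theorem legendre_rotated (f : Euc n → EReal) (ϑ : On n) :
    legendre (rotated f ϑ) = rotated (legendre f) ϑ := by
  funext y
  refine EReal.eq_of_forall_le_coe_iff fun c => ?_
  rw [rotated_eq, legendre_le_coe_iff, legendre_le_coe_iff]
  simp only [rotated_eq]
  constructor
  · intro h x
    have := h (orthAct ϑ x)
    rwa [orthAct_inv_orthAct, real_inner_comm, inner_orthAct_left, real_inner_comm] at this
  · intro h x
    have := h (orthAct ϑ⁻¹ x)
    rwa [inner_orthAct_left, inv_inv, orthAct_orthAct_inv] at this

instance isProbabilityMeasure_haarSOn (n : ℕ) : IsProbabilityMeasure (haarSOn n) :=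
  ⟨by
    have := Measure.haarMeasure_self (G := SOn n) (K₀ := ⊤)
    rwa [TopologicalSpace.PositiveCompacts.coe_top] at this⟩

/-! ### Rotational averages -/

theorem measurable_rotated {g : Euc n → EReal} (hg : LowerSemicontinuous g) (x : Euc n) :
    Measurable fun ϑ : SOn n => rotated g (ϑ : On n) x :=
  LowerSemicontinuous.measurable (hg.comp_cont (continuous_orthAct_inv_left x))

/-- A conjugate function is bounded from below on bounded sets. -/
theorem exists_le_legendre {f : Euc n → EReal} (hp : ∃ x, f x < ⊤) (hbot : ∀ x, f x ≠ ⊥) (R : ℝ) :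
    ∃ M : ℝ, 0 ≤ M ∧ ∀ y, ‖y‖ ≤ R → ((-M : ℝ) : EReal) ≤ legendre f y := by
  obtain ⟨x, hx⟩ := hp
  lift f x to ℝ using ⟨hx.ne, hbot x⟩ with m hm
  refine ⟨max 0 (R * ‖x‖ + m), le_max_left _ _, fun y hy => ?_⟩
  refine le_trans ?_ (le_iSup (fun x => ((inner ℝ y x : ℝ) : EReal) - f x) x)
  rw [← hm, ← EReal.coe_sub, EReal.coe_le_coe_iff]
  have := neg_le_of_abs_le (abs_real_inner_le_norm y x)
  have := mul_le_mul_of_nonneg_right hy (norm_nonneg x)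
  have := le_max_right 0 (R * ‖x‖ + m)
  linarith

/-- Functions bounded from below on bounded sets. -/
def LocBddBelow (g : Euc n → EReal) : Prop :=
  ∀ R : ℝ, ∃ M : ℝ, 0 ≤ M ∧ ∀ y, ‖y‖ ≤ R → ((-M : ℝ) : EReal) ≤ g y

theorem IsConvC.locBddBelow_legendre {f : Euc n → EReal} (hf : IsConvC f) :
    LocBddBelow (legendre f) := exists_le_legendre hf.proper hf.ne_bot

variable {g : Euc n → EReal}

theorem rotAverage_ne_bot (hg : LowerSemicontinuous g) (hb : LocBddBelow g) (x : Euc n) :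
    rotAverage g x ≠ ⊥ := by
  obtain ⟨M, hM, h⟩ := hb ‖x‖
  exact eintegral_ne_bot (measurable_rotated hg x) hM fun ϑ => h _ (norm_orthAct _ x).le

theorem rotAverage_eq_integral (hg : LowerSemicontinuous g) (hb : LocBddBelow g) {x : Euc n}
    (hx : rotAverage g x < ⊤) :
    (∀ᵐ ϑ : SOn n ∂haarSOn n, rotated g (ϑ : On n) x < ⊤) ∧
      Integrable (fun ϑ : SOn n => (rotated g (ϑ : On n) x).toReal) (haarSOn n) ∧
      rotAverage g x = ((∫ ϑ : SOn n, (rotated g (ϑ : On n) x).toReal ∂haarSOn n : ℝ) : EReal) := by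
  obtain ⟨M, hM, h⟩ := hb ‖x‖
  exact eintegral_eq_integral (measurable_rotated hg x) hM (fun ϑ => h _ (norm_orthAct _ x).le) hx

theorem rotAverage_le_integral (hg : LowerSemicontinuous g) (hb : LocBddBelow g) {x : Euc n}
    {u : SOn n → ℝ} (hu : Integrable u (haarSOn n))
    (hgu : ∀ᵐ ϑ : SOn n ∂haarSOn n, rotated g (ϑ : On n) x ≤ (u ϑ : EReal)) :
    rotAverage g x ≤ ((∫ ϑ, u ϑ ∂haarSOn n : ℝ) : EReal) := by
  obtain ⟨M, hM, h⟩ := hb ‖x‖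
  exact eintegral_le_integral (measurable_rotated hg x) hM (fun ϑ => h _ (norm_orthAct _ x).le) hu hgu

theorem rotAverage_le_of_forall_norm (hg : LowerSemicontinuous g) (hb : LocBddBelow g) {x : Euc n}
    {c : ℝ} (hc : ∀ y, ‖y‖ = ‖x‖ → g y ≤ c) : rotAverage g x ≤ c := by
  have := rotAverage_le_integral hg hb (x := x) (integrable_const c)
    (Eventually.of_forall fun ϑ => hc _ (norm_orthAct _ x))
  simpa using this

theorem EConvex.rotAverage (hc : EConvex g) (hg : LowerSemicontinuous g) (hb : LocBddBelow g) :
    EConvex (rotAverage g) := by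
  intro x y a b ha hb' hab r s hr hs
  obtain ⟨hx1, hx2, hx3⟩ := rotAverage_eq_integral hg hb (hr.trans_lt (EReal.coe_lt_top _))
  obtain ⟨hy1, hy2, hy3⟩ := rotAverage_eq_integral hg hb (hs.trans_lt (EReal.coe_lt_top _))
  rw [hx3, EReal.coe_le_coe_iff] at hr
  rw [hy3, EReal.coe_le_coe_iff] at hs
  refine (rotAverage_le_integral hg hb ((hx2.const_mul a).add (hy2.const_mul b)) ?_).trans ?_
  · filter_upwards [hx1, hy1] with ϑ h1 h2
    rw [rotated_eq, orthAct_lin]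
    exact hc _ _ a b ha hb' hab _ _ (EReal.le_coe_toReal h1.ne) (EReal.le_coe_toReal h2.ne)
  · rw [EReal.coe_le_coe_iff]
    simp only [Pi.add_apply]
    rw [integral_add (hx2.const_mul a) (hy2.const_mul b), integral_const_mul, integral_const_mul]
    gcongr

/-- Fatou's lemma along a sequence violating semicontinuity. Rotations preserve norms, so all the
points stay in one ball, where a single shift `M` makes the integrands nonnegative. -/
theorem lowerSemicontinuous_rotAverage (hg : LowerSemicontinuous g) (hb : LocBddBelow g) :
    LowerSemicontinuous (rotAverage g) := by
  refine lowerSemicontinuous_of_real fun x r hr => ?_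
  by_contra hcon
  rw [not_eventually] at hcon
  have hfreq : ∃ᶠ x' in 𝓝 x, rotAverage g x' < r ∧ ‖x'‖ ≤ ‖x‖ + 1 := by
    refine (hcon.mono fun x' h => not_le.1 h).and_eventually ?_
    filter_upwards [continuous_norm.continuousAt.eventually (gt_mem_nhds (lt_add_one ‖x‖))] with
      x' hx' using hx'.le
  obtain ⟨u, hu, hur⟩ := exists_seq_forall_of_frequently hfreq
  obtain ⟨M, hM, h⟩ := hb (‖x‖ + 1)
  have hlow : ∀ z : Euc n, ‖z‖ ≤ ‖x‖ + 1 → ∀ ϑ : SOn n,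
      ((-M : ℝ) : EReal) ≤ rotated g (ϑ : On n) z := fun z hz ϑ => h _ ((norm_orthAct _ z).le.trans hz)
  refine hr.not_ge ?_
  rw [rotAverage, eintegral_le_coe_iff (measurable_rotated hg x) hM (hlow x (by linarith))]
  have hk : ∀ k, (∫⁻ ϑ : SOn n, (rotated g (ϑ : On n) (u k) + (M : EReal)).toENNReal ∂haarSOn n) ≤
      ((r + M : ℝ) : EReal).toENNReal := by
    intro k
    have := (eintegral_le_coe_iff (measurable_rotated hg (u k)) hM (hlow _ (hur k).2) r).1
      (hur k).1.le
    have := EReal.toENNReal_le_toENNReal this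
    rwa [EReal.toENNReal_coe] at this
  have hrM : 0 ≤ r + M := by
    have := (eintegral_le_coe_iff (measurable_rotated hg (u 0)) hM (hlow _ (hur 0).2) r).1
      (hur 0).1.le
    have := (EReal.coe_ennreal_nonneg _).trans this
    rwa [← EReal.coe_zero, EReal.coe_le_coe_iff] at this
  rw [← EReal.coe_toENNReal (EReal.coe_nonneg.2 hrM), EReal.coe_ennreal_le_coe_ennreal_iff]
  calc (∫⁻ ϑ : SOn n, (rotated g (ϑ : On n) x + (M : EReal)).toENNReal ∂haarSOn n)
      ≤ ∫⁻ ϑ : SOn n, liminf (fun k => (rotated g (ϑ : On n) (u k) + (M : EReal)).toENNReal) atTop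
          ∂haarSOn n := by
        refine lintegral_mono fun ϑ => ?_
        have hl : LowerSemicontinuous fun z => (rotated g (ϑ : On n) z + (M : EReal)).toENNReal := by
          have h1 : LowerSemicontinuous fun z => rotated g (ϑ : On n) z :=
            hg.comp_cont (continuous_orthAct _)
          have h2 : Continuous fun t : EReal => (t + (M : EReal)).toENNReal := by
            refine EReal.continuous_toENNReal.comp (continuous_iff_continuousAt.2 fun t => ?_)
            exact (EReal.continuousAt_add (p := (t, (M : EReal))) (by simp) (by simp)).comp
              (f := fun t : EReal => (t, (M : EReal))) (by fun_prop)
          exact h2.comp_lowerSemicontinuous h1 fun s t hst =>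
            EReal.toENNReal_le_toENNReal (add_le_add hst le_rfl)
        exact (lowerSemicontinuousAt_iff_le_liminf.1 (hl x)).trans
          (liminf_le_liminf_of_le hu : _ ≤ liminf _ (map u atTop))
    _ ≤ liminf (fun k => ∫⁻ ϑ : SOn n, (rotated g (ϑ : On n) (u k) + (M : EReal)).toENNReal
          ∂haarSOn n) atTop :=
        lintegral_liminf_le fun k => ((measurable_rotated hg (u k)).add_const _).ereal_toENNReal
    _ ≤ ((r + M : ℝ) : EReal).toENNReal :=
        (liminf_le_liminf (Eventually.of_forall hk)).trans (liminf_const _).le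

end Rotations

/-! ### Rotational epi-symmetrization -/

section RotSymm

variable {n : ℕ}

theorem exists_closedBall_of_mem_eball {f : Euc n → EReal} {y : Euc n}
    (hy : y ∈ Metric.eball (0 : Euc n) (conjRadius f)) :
    ∃ ρ : ℝ, Metric.closedBall (0 : Euc n) ρ ⊆ effDom (legendre f) ∧ ‖y‖ < ρ := by
  rw [Metric.mem_eball, conjRadius] at hy
  obtain ⟨ρ, hρ⟩ := lt_iSup_iff.1 hy
  obtain ⟨h, hlt⟩ := lt_iSup_iff.1 hρ
  refine ⟨ρ, h, ?_⟩
  rw [edist_zero_right, enorm_eq_nnnorm] at hlt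
  exact_mod_cast hlt

/-- A convex function that is finite on a ball is bounded on smaller balls. -/
theorem EConvex.exists_le_of_closedBall {f : Euc n → EReal} (hf : EConvex f)
    (hbot : ∀ x, f x ≠ ⊥) {ρ r : ℝ} (hρ : Metric.closedBall (0 : Euc n) ρ ⊆ effDom f)
    (hr : r < ρ) : ∃ c : ℝ, ∀ y, ‖y‖ ≤ r → f y ≤ c := by
  have hsub : Metric.ball (0 : Euc n) ρ ⊆ effDom f := Metric.ball_subset_closedBall.trans hρ
  have hcont := (hf.convexOn_toReal hbot (convex_ball 0 ρ) hsub).continuousOn Metric.isOpen_ball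
  obtain ⟨c, hc⟩ := (isCompact_closedBall (0 : Euc n) r).bddAbove_image
    (hcont.mono (Metric.closedBall_subset_ball hr))
  refine ⟨c, fun y hy => ?_⟩
  have hy' : y ∈ Metric.closedBall (0 : Euc n) r := mem_closedBall_zero_iff.2 hy
  have hfin := hsub (Metric.closedBall_subset_ball hr hy')
  refine (EReal.le_coe_toReal hfin.ne).trans (EReal.coe_le_coe_iff.2 ?_)
  exact hc (Set.mem_image_of_mem _ hy')

/-- The reflection at the origin. -/
def negOn (n : ℕ) : On n :=
  ⟨-1, (Matrix.mem_orthogonalGroup_iff (Fin n) ℝ).2 (by simp)⟩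

theorem orthAct_negOn_inv (x : Euc n) : orthAct (negOn n)⁻¹ x = -x := by
  have h : orthAct (negOn n) (-x) = x := by simp [orthAct, negOn]
  rw [← orthAct_inv_orthAct (negOn n) (-x), h]

theorem rotated_negOn (f : Euc n → EReal) : rotated f (negOn n) = fun x => f (-x) := by
  funext x
  rw [rotated_eq, orthAct_negOn_inv]

/-- For `n ≠ 1` the averaged conjugate is closed, proper, convex and bounded above near `0`; by
Fenchel-Moreau it is the conjugate of its own conjugate, and a conjugate determines its function in
`Conv_c`. -/
theorem existsUnique_isRotSymm (ψ : ConvC n) : ∃! φ : ConvC n, IsRotSymm ψ φ := by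
  by_cases hn : n = 1
  · simp only [IsRotSymm, if_pos hn]
    refine ⟨⟨_, (ψ.2.infConv (ψ.2.rotated (negOn n))).epiMul one_half_pos⟩, ?_, fun φ hφ => ?_⟩
    · simp only [rotated_negOn]
    · exact Subtype.ext (by simpa only [rotated_negOn] using hφ)
  · simp only [IsRotSymm, if_neg hn]
    have hl := lowerSemicontinuous_legendre ψ.1
    have hb := ψ.2.locBddBelow_legendre
    have hc := (econvex_legendre ψ.1).rotAverage hl hb
    have hl' := lowerSemicontinuous_rotAverage hl hb
    have hbot := rotAverage_ne_bot hl hb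
    obtain ⟨δ, hδ, c, hle⟩ := ψ.2.exists_legendre_le
    have hle' : ∀ y, ‖y‖ ≤ δ → rotAverage (legendre ψ.1) y ≤ c := fun y hy =>
      rotAverage_le_of_forall_norm hl hb fun z hz => hle z (hz.trans_le hy)
    have hp : ∃ y, rotAverage (legendre ψ.1) y < ⊤ :=
      ⟨0, (hle' 0 (by simpa using hδ.le)).trans_lt (EReal.coe_lt_top c)⟩
    refine ⟨⟨_, isConvC_legendre hc hl' hbot hδ hle'⟩, hc.legendre_legendre hl' hp hbot,
      fun φ hφ => Subtype.ext ?_⟩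
    simp only [← hφ]
    exact φ.2.legendre_legendre.symm

theorem legendre_of_isRotSymm_one {ψ φ : ConvC n} (hn : n = 1) (h : IsRotSymm ψ φ) (y : Euc n) :
    legendre φ.1 y = ((1 / 2 : ℝ) : EReal) * (legendre ψ.1 y + legendre ψ.1 (-y)) := by
  rw [IsRotSymm, if_pos hn, ← rotated_negOn] at h
  rw [h, legendre_epiMul _ one_half_pos, legendre_infConv ψ.2 (ψ.2.rotated _), legendre_rotated,
    rotated_negOn]

/-- The average only sees the sphere through `y`. The slack `‖y‖ < ρ` makes `𝓛ψ` bounded there, not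
merely finite. -/
theorem legendre_lt_top_of_isRotSymm {ψ φ : ConvC n} (h : IsRotSymm ψ φ) {y : Euc n} {ρ : ℝ}
    (hρ : Metric.closedBall (0 : Euc n) ρ ⊆ effDom (legendre ψ.1)) (hy : ‖y‖ < ρ) :
    legendre φ.1 y < ⊤ := by
  obtain ⟨c, hc⟩ := (econvex_legendre ψ.1).exists_le_of_closedBall (legendre_ne_bot ψ.2.proper)
    hρ hy
  by_cases hn : n = 1
  · rw [legendre_of_isRotSymm_one hn h]
    have := add_le_add (hc y le_rfl) (hc (-y) (norm_neg y).le)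
    rw [← EReal.coe_add] at this
    refine lt_of_le_of_lt ((EReal.coe_mul_le_coe_iff one_half_pos _ c).2 ?_) (EReal.coe_lt_top c)
    refine this.trans (EReal.coe_le_coe_iff.2 ?_)
    linarith
  · rw [IsRotSymm, if_neg hn] at h
    rw [h]
    exact (rotAverage_le_of_forall_norm (lowerSemicontinuous_legendre _) ψ.2.locBddBelow_legendre
      fun z hz => hc z hz.le).trans_lt (EReal.coe_lt_top c)

/-- The values of `𝓛 φ`, for the symmetrization `φ` of `ψ`, are averages of values of `𝓛 ψ` over the
group of motions. -/
theorem legendre_mem_of_isRotSymm {ψ φ : ConvC n} (h : IsRotSymm ψ φ) {ι : Type*} [Fintype ι]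
    {v : ι → Euc n} {η : On n} (hη : η ∈ motionGroup n)
    (hv : ∀ i, rotated (legendre φ.1) η (v i) < ⊤) {A : Set (ι → ℝ)} (hA : Convex ℝ A)
    (hAc : IsClosed A)
    (hmem : ∀ ϑ ∈ motionGroup n, (∀ i, rotated (legendre ψ.1) ϑ (v i) < ⊤) →
      (fun i => (rotated (legendre ψ.1) ϑ (v i)).toReal) ∈ A) :
    (fun i => (rotated (legendre φ.1) η (v i)).toReal) ∈ A := by
  have hbot := legendre_ne_bot ψ.2.proper
  -- Rotating the average by `η` averages over the coset elements `η * ϑ`, which are again in the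
  -- motion group.
  have hmul : ∀ (ϑ : On n) (x : Euc n), rotated (legendre ψ.1) ϑ (orthAct η⁻¹ x) =
      rotated (legendre ψ.1) (η * ϑ) x := fun ϑ x => by
    rw [rotated_eq, rotated_eq, mul_inv_rev, orthAct_mul]
  by_cases hn : n = 1
  · have key : ∀ i, ∃ p q : ℝ, rotated (legendre ψ.1) η (v i) = p ∧
        rotated (legendre ψ.1) (η * negOn n) (v i) = q ∧
        rotated (legendre φ.1) η (v i) = ((1 / 2 * p + 1 / 2 * q : ℝ) : EReal) := by
      intro i
      have h1 := hv i
      rw [← hmul, rotated_negOn]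
      beta_reduce
      rw [rotated_eq, legendre_of_isRotSymm_one hn h] at h1
      rw [rotated_eq, rotated_eq, legendre_of_isRotSymm_one hn h]
      have hu := hbot (orthAct η⁻¹ (v i))
      have hw := hbot (-orthAct η⁻¹ (v i))
      generalize legendre ψ.1 (orthAct η⁻¹ (v i)) = u at *
      generalize legendre ψ.1 (-orthAct η⁻¹ (v i)) = w at *
      have hut : u ≠ ⊤ := by
        rintro rfl
        rw [EReal.top_add_of_ne_bot hw, EReal.coe_mul_top_of_pos one_half_pos] at h1
        exact lt_irrefl _ h1
      have hwt : w ≠ ⊤ := by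
        rintro rfl
        rw [EReal.add_top_of_ne_bot hu, EReal.coe_mul_top_of_pos one_half_pos] at h1
        exact lt_irrefl _ h1
      lift u to ℝ using ⟨hut, hu⟩
      lift w to ℝ using ⟨hwt, hw⟩
      refine ⟨u, w, rfl, rfl, ?_⟩
      rw [← EReal.coe_add, ← EReal.coe_mul, mul_add]
    choose p q hp hq hpq using key
    have h1 := hmem η hη fun i => by rw [hp]; exact EReal.coe_lt_top _
    have h2 := hmem (η * negOn n) (by simp [motionGroup, hn]) fun i => by
      rw [hq]; exact EReal.coe_lt_top _
    have h3 := hA h1 h2 one_half_pos.le one_half_pos.le (add_halves (1 : ℝ))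
    convert h3 using 1
    funext i
    simp [hp, hq, hpq, -one_div, -EReal.coe_add, -EReal.coe_mul]
  · rw [IsRotSymm, if_neg hn] at h
    rw [motionGroup, if_neg hn] at hη hmem
    have hl := lowerSemicontinuous_legendre ψ.1
    have hb := ψ.2.locBddBelow_legendre
    have hI := fun i => rotAverage_eq_integral hl hb (x := orthAct η⁻¹ (v i))
      (by have := hv i; rwa [rotated_eq, h] at this)
    simp only [hmul] at hI
    have hint : Integrable (fun (ϑ : SOn n) i =>
        (rotated (legendre ψ.1) (η * (ϑ : On n)) (v i)).toReal) (haarSOn n) :=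
      Integrable.of_eval fun i => (hI i).2.1
    -- A finite average forces finite values almost everywhere, so almost every vector lies in `A`,
    -- and so does its Haar mean.
    have := hA.integral_mem hAc ?_ hint
    · convert this using 1
      funext i
      rw [eval_integral fun i => (hI i).2.1, rotated_eq, h, (hI i).2.2, EReal.toReal_coe]
    · filter_upwards [ae_all_iff.2 fun i => (hI i).1] with ϑ hϑ
      exact hmem _ (mul_mem hη ϑ.2) hϑ

end RotSymm

/-! ### Epi-convergence of suprema of affine functions -/

section Epi

variable {n : ℕ}

/-- A finite maximum of affine functions is jointly continuous in the point and the intercepts. -/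
theorem epiConverges_affSup_of_tendsto {ι : Type*} [Fintype ι] (v : ι → Euc n)
    {a : ℕ → ι → ℝ} {b : ι → ℝ} (h : Tendsto a atTop (𝓝 b)) :
    EpiConverges (fun k => affSup v (a k)) (affSup v b) := by
  have key : ∀ (x : Euc n) (u : ℕ → Euc n), Tendsto u atTop (𝓝 x) →
      Tendsto (fun k => affSup v (a k) (u k)) atTop (𝓝 (affSup v b x)) := by
    intro x u hu
    simp only [affSup, ← Finset.sup_univ_eq_iSup]
    refine Filter.Tendsto.finset_sup_nhds_apply fun i _ => ?_
    refine (continuous_coe_real_ereal.tendsto _).comp ?_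
    exact (hu.inner tendsto_const_nhds).sub ((continuous_apply i).continuousAt.tendsto.comp h)
  exact fun x => ⟨fun u hu => (key x u hu).liminf_eq.ge,
    fun _ => x, tendsto_const_nhds, key x _ tendsto_const_nhds⟩

/-- A supremum of affine functions is the epi-limit of suprema over finite subfamilies which
exhaust a dense subfamily. -/
theorem epiConverges_affSup_of_dense {S : Type*} {v : S → Euc n} {a : S → ℝ} {ι : ℕ → Type*}
    (e : ∀ k, ι k → S) (w : ℕ → S) (hw : ∀ j k, j < k → w j ∈ Set.range (e k))
    (hd : ∀ s, (v s, a s) ∈ closure (Set.range fun j => (v (w j), a (w j)))) :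
    EpiConverges (fun k => affSup (fun i => v (e k i)) fun i => a (e k i)) (affSup v a) := by
  have hle : ∀ k x, affSup (fun i => v (e k i)) (fun i => a (e k i)) x ≤ affSup v a x :=
    fun k x => iSup_le fun i => le_iSup (fun s => ((inner ℝ x (v s) - a s : ℝ) : EReal)) (e k i)
  have key : ∀ (x : Euc n) (u : ℕ → Euc n), Tendsto u atTop (𝓝 x) → affSup v a x ≤
      liminf (fun k => affSup (fun i => v (e k i)) (fun i => a (e k i)) (u k)) atTop := by
    intro x u hu
    refine iSup_le fun s => EReal.ge_of_forall_gt_iff_ge.1 fun t ht => ?_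
    rw [EReal.coe_lt_coe_iff] at ht
    have hopen : IsOpen {p : Euc n × ℝ | t < inner ℝ x p.1 - p.2} :=
      isOpen_lt continuous_const (by fun_prop)
    -- Exceeding `t` at `x` is an open condition on slope and intercept, so some piece of the dense
    -- subfamily satisfies it; that piece belongs to all later families.
    obtain ⟨_, hp, j, rfl⟩ := mem_closure_iff.1 (hd s) _ hopen ht
    have hlim : Tendsto (fun k => inner ℝ (u k) (v (w j)) - a (w j)) atTop
        (𝓝 (inner ℝ x (v (w j)) - a (w j))) :=
      (hu.inner tendsto_const_nhds).sub tendsto_const_nhds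
    refine le_liminf_of_le (by isBoundedDefault) ?_
    filter_upwards [hlim.eventually (lt_mem_nhds hp), eventually_gt_atTop j] with k hk hjk
    obtain ⟨i, hi⟩ := hw j k hjk
    refine (EReal.coe_le_coe_iff.2 hk.le).trans ?_
    rw [← hi]
    exact le_iSup (fun i => ((inner ℝ (u k) (v (e k i)) - a (e k i) : ℝ) : EReal)) i
  refine fun x => ⟨key x, fun _ => x, tendsto_const_nhds, ?_⟩
  refine tendsto_of_le_liminf_of_limsup_le (key x _ tendsto_const_nhds) ?_
  exact limsup_le_of_le (by isBoundedDefault) (Eventually.of_forall fun k => hle k x)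

end Epi

/-! ### Superlevel sets of the functional -/

section Functional

variable {n : ℕ} {Φ : ConvC n → EReal}

/-- Pieces with the same slope in the two summands add up to the piece with the combined intercept.
The inequality can be strict, and monotonicity of `Φ` absorbs the gap. -/
theorem affSup_convexComb_le {ι : Type*} (v : ι → Euc n) (a b : ι → ℝ) {l m : ℝ} (hl : 0 < l)
    (hm : 0 < m) (x : Euc n) :
    affSup v (l • a + m • b) x ≤ infConv (epiMul l (affSup v a)) (epiMul m (affSup v b)) x := by
  refine le_iInf fun y => iSup_le fun i => ?_
  have h1 := mul_le_mul_of_nonneg_left (le_iSup (fun i =>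
    ((inner ℝ (l⁻¹ • (x - y)) (v i) - a i : ℝ) : EReal)) i) (EReal.coe_nonneg.2 hl.le)
  have h2 := mul_le_mul_of_nonneg_left (le_iSup (fun i =>
    ((inner ℝ (m⁻¹ • y) (v i) - b i : ℝ) : EReal)) i) (EReal.coe_nonneg.2 hm.le)
  refine le_trans (le_of_eq ?_) (add_le_add h1 h2)
  rw [← EReal.coe_mul, ← EReal.coe_mul, ← EReal.coe_add, real_inner_smul_left,
    real_inner_smul_left, inner_sub_left]
  congr 1
  simp only [Pi.add_apply, Pi.smul_apply, smul_eq_mul]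
  field_simp
  ring

variable {ι : Type*} [Fintype ι] {v : ι → Euc n}

theorem convex_superlevel (hconc : EpiConcave Φ) (hmono : EpiDecreasing Φ) (hv : SpansPos v)
    (c : EReal) : Convex ℝ {a : ι → ℝ | c ≤ Φ ⟨affSup v a, isConvC_affSup_of_fintype hv a⟩} := by
  rw [convex_iff_forall_pos]
  intro a ha b hb l m hl hm hlm
  obtain rfl : m = 1 - l := by linarith
  have hca := isConvC_affSup_of_fintype hv a
  have hcb := isConvC_affSup_of_fintype hv b
  have h1 := hconc ⟨_, hca⟩ ⟨_, hcb⟩ ⟨_, (hca.epiMul hl).infConv (hcb.epiMul hm)⟩ l hl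
    (by linarith) rfl
  have h2 := hmono ⟨_, (hca.epiMul hl).infConv (hcb.epiMul hm)⟩
    ⟨_, isConvC_affSup_of_fintype hv (l • a + (1 - l) • b)⟩ (affSup_convexComb_le v a b hl hm)
  refine le_trans ?_ (h1.trans h2)
  refine le_trans (le_of_eq ?_) (add_le_add
    (mul_le_mul_of_nonneg_left ha (EReal.coe_nonneg.2 hl.le))
    (mul_le_mul_of_nonneg_left hb (EReal.coe_nonneg.2 hm.le)))
  induction c with
  | bot => rw [EReal.coe_mul_bot_of_pos hl, EReal.bot_add]
  | top => rw [EReal.coe_mul_top_of_pos hl, EReal.coe_mul_top_of_pos hm]; rfl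
  | coe c =>
    rw [← EReal.coe_mul, ← EReal.coe_mul, ← EReal.coe_add]
    congr 1
    ring

theorem isClosed_superlevel (husc : EpiUSC Φ) (hv : SpansPos v) (c : EReal) :
    IsClosed {a : ι → ℝ | c ≤ Φ ⟨affSup v a, isConvC_affSup_of_fintype hv a⟩} := by
  refine IsSeqClosed.isClosed fun a b ha hab => ?_
  refine le_trans ?_ (husc (fun k => ⟨affSup v (a k), isConvC_affSup_of_fintype hv (a k)⟩)
    ⟨affSup v b, isConvC_affSup_of_fintype hv b⟩ (epiConverges_affSup_of_tendsto v hab))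
  exact le_limsup_of_le (by isBoundedDefault) fun d hd => by
    obtain ⟨k, hk⟩ := hd.exists
    exact (ha k).trans hk

theorem le_affSup_of_isRotSymm (husc : EpiUSC Φ) (hconc : EpiConcave Φ) (hmono : EpiDecreasing Φ)
    {ψ φ : ConvC n} (h : IsRotSymm ψ φ) (hv : SpansPos v) {Y : Set (Euc n)} (hvY : ∀ i, v i ∈ Y)
    (hY : ∀ ϑ, IsConvC (outerLin (rotated ψ.1 ϑ) Y)) {c : EReal}
    (hc : ∀ ϑ ∈ motionGroup n, c ≤ Φ ⟨_, hY ϑ⟩) {η : On n} (hη : η ∈ motionGroup n)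
    (hvt : ∀ i, rotated (legendre φ.1) η (v i) < ⊤) :
    c ≤ Φ ⟨affSup v fun i => (rotated (legendre φ.1) η (v i)).toReal,
      isConvC_affSup_of_fintype hv _⟩ := by
  refine legendre_mem_of_isRotSymm h hη hvt (convex_superlevel hconc hmono hv c)
    (isClosed_superlevel husc hv c) fun ϑ hϑ hlt => ?_
  refine (hc ϑ hϑ).trans (hmono _ _ fun x => ?_)
  simp only [outerLin_eq (ψ.2.rotated ϑ).proper, legendre_rotated]
  unfold affSup
  exact iSup_le fun i => le_iSup
    (fun y : {y // y ∈ Y ∧ legendre (rotated ψ.1 ϑ) y < ⊤} =>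
      ((inner ℝ x (y : Euc n) - (rotated (legendre ψ.1) ϑ y).toReal : ℝ) : EReal))
    ⟨v i, hvY i, by rw [legendre_rotated]; exact hlt i⟩

/-- Passage from finite families to arbitrary `Y`, by exhausting a countable dense part of the
slope-intercept pairs. -/
theorem le_outerLin_of_isRotSymm (husc : EpiUSC Φ) (hconc : EpiConcave Φ) (hmono : EpiDecreasing Φ)
    {ψ φ : ConvC n} (h : IsRotSymm ψ φ) {Y : Set (Euc n)} {F : Finset (Euc n)}
    (hFY : (F : Set (Euc n)) ⊆ Y) (hF : SpansPos fun y : F => (y : Euc n))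
    (hY : ∀ ϑ, IsConvC (outerLin (rotated ψ.1 ϑ) Y)) {c : EReal}
    (hc : ∀ ϑ ∈ motionGroup n, c ≤ Φ ⟨_, hY ϑ⟩) {η : On n} (hη : η ∈ motionGroup n)
    (hFt : ∀ y ∈ F, rotated (legendre φ.1) η y < ⊤) (hconv : IsConvC (outerLin (rotated φ.1 η) Y)) :
    c ≤ Φ ⟨_, hconv⟩ := by
  let S := {y // y ∈ Y ∧ rotated (legendre φ.1) η y < ⊤}
  let a : S → ℝ := fun s => (rotated (legendre φ.1) η (s : Euc n)).toReal
  have hS : Nonempty S := by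
    obtain ⟨δ, -, hδ⟩ := hF
    obtain ⟨y, -⟩ := hδ 0
    exact ⟨⟨y, hFY y.2, hFt y y.2⟩⟩
  -- Density is taken in the graph of `a` in `ℝⁿ × ℝ`, not just among slopes, since `a` need not be
  -- continuous on `Y`.
  obtain ⟨w, hw⟩ : ∃ w : ℕ → S,
      ∀ s : S, ((s : Euc n), a s) ∈ closure (Set.range fun j => ((w j : Euc n), a (w j))) := by
    let T : Set (Euc n × ℝ) := Set.range fun s : S => ((s : Euc n), a s)
    have : Nonempty T := (Set.range_nonempty _).to_subtype
    choose w hw using fun j => (TopologicalSpace.denseSeq T j).2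
    refine ⟨w, fun s => ?_⟩
    simp only at hw
    simp only [hw]
    have hd := TopologicalSpace.denseRange_denseSeq T ⟨_, s, rfl⟩
    rw [closure_subtype, ← Set.range_comp] at hd
    exact hd
  -- Keeping `F` in every family makes each finite supremum coercive; repeated slopes do no harm.
  let e : ∀ k : ℕ, F ⊕ Fin k → S := fun k =>
    Sum.elim (fun y => ⟨y, hFY y.2, hFt y y.2⟩) fun j => w j
  have hspan : ∀ k, SpansPos fun i => (e k i : Euc n) := by
    intro k
    obtain ⟨δ, hδ, hx⟩ := hF
    refine ⟨δ, hδ, fun x => ?_⟩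
    obtain ⟨y, hy⟩ := hx x
    exact ⟨Sum.inl y, hy⟩
  have hepi := epiConverges_affSup_of_dense (v := fun s : S => (s : Euc n)) (a := a) e w
    (fun j k hjk => ⟨Sum.inr ⟨j, hjk⟩, rfl⟩) hw
  have hval : ∀ k, c ≤ Φ ⟨_, isConvC_affSup_of_fintype (hspan k) fun i => a (e k i)⟩ := fun k =>
    le_affSup_of_isRotSymm husc hconc hmono h (hspan k) (fun i => (e k i).2.1) hY hc hη
      fun i => (e k i).2.2
  have hout : outerLin (rotated φ.1 η) Y = affSup (fun s : S => (s : Euc n)) a := by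
    rw [outerLin_eq (φ.2.rotated η).proper, legendre_rotated]
  rw [← hout] at hepi
  refine le_trans ?_ (husc (fun k => ⟨_, isConvC_affSup_of_fintype (hspan k) fun i => a (e k i)⟩)
    ⟨_, hconv⟩ hepi)
  exact le_limsup_of_le (by isBoundedDefault) fun d hd => by
    obtain ⟨k, hk⟩ := hd.exists
    exact (hval k).trans hk

end Functional

/-! ### The symmetrization inequality -/

theorem theorem2p2 (n : ℕ) (hn : 1 ≤ n) (Φ : ConvC n → EReal) (hone : OneSided Φ)
    (husc : EpiUSC Φ) (hconc : EpiConcave Φ) (hmono : EpiDecreasing Φ)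
    (ψ : ConvC n) (𝒴 : Set (Set (Euc n))) (h𝒴 : 𝒴 ⊆ admissibleSlopes ψ.1) :
    (∃! φ : ConvC n, IsRotSymm ψ φ) ∧
    ∀ ψrot : ConvC n, IsRotSymm ψ ψrot →
      bestValue Φ ψ 𝒴 ≤ bestValue Φ ψrot 𝒴 ∧
      ∀ Y ∈ 𝒴, ∀ ϑ : On n,
        IsConvC (outerLin (rotated ψ.1 ϑ) Y) ∧ IsConvC (outerLin (rotated ψrot.1 ϑ) Y) := by
  refine ⟨existsUnique_isRotSymm ψ, fun φ hφ => ?_⟩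
  have hψfin : ∀ y ∈ Metric.eball (0 : Euc n) (conjRadius ψ.1), ∀ ϑ : On n,
      legendre (rotated ψ.1 ϑ) y < ⊤ := by
    intro y hy ϑ
    obtain ⟨ρ, hρ, hlt⟩ := exists_closedBall_of_mem_eball hy
    rw [legendre_rotated]
    exact hρ (mem_closedBall_zero_iff.2 ((norm_orthAct _ y).trans_le hlt.le))
  have hφfin : ∀ y ∈ Metric.eball (0 : Euc n) (conjRadius ψ.1), ∀ ϑ : On n,
      legendre (rotated φ.1 ϑ) y < ⊤ := by
    intro y hy ϑ
    obtain ⟨ρ, hρ, hlt⟩ := exists_closedBall_of_mem_eball hy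
    rw [legendre_rotated]
    exact legendre_lt_top_of_isRotSymm hφ hρ ((norm_orthAct _ y).trans_lt hlt)
  have hconv : ∀ Y ∈ 𝒴, ∀ ϑ : On n,
      IsConvC (outerLin (rotated ψ.1 ϑ) Y) ∧ IsConvC (outerLin (rotated φ.1 ϑ) Y) := by
    intro Y hY ϑ
    obtain ⟨Y₀, hY₀, hpos, hball⟩ := h𝒴 hY
    exact ⟨(ψ.2.rotated ϑ).outerLin hn hY₀ hpos fun y hy => hψfin y (hball hy) ϑ,
      (φ.2.rotated ϑ).outerLin hn hY₀ hpos fun y hy => hφfin y (hball hy) ϑ⟩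
  refine ⟨?_, hconv⟩
  refine le_iInf fun η => le_iInf fun hη => le_iInf fun Y => le_iInf fun hY => le_iInf fun h => ?_
  obtain ⟨Y₀, hY₀, hpos, hball⟩ := h𝒴 hY
  obtain ⟨F, hF, hspan⟩ := exists_finset_spansPos hn hpos
  -- The level `c` is `bestValue Φ ψ 𝒴` itself, a lower bound for all rotations with this same `Y`.
  refine le_outerLin_of_isRotSymm husc hconc hmono hφ (hF.trans hY₀) hspan
    (fun ϑ => (hconv Y hY ϑ).1) (fun ϑ hϑ => ?_) hη (fun y hy => ?_) h
  · exact iInf_le_of_le ϑ (iInf_le_of_le hϑ (iInf_le_of_le Y (iInf_le_of_le hY (iInf_le _ _))))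
  · rw [← legendre_rotated]
    exact hφfin y (hball (hF hy)) η
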